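/- Let $H$ be an infinite-dimensional complex Hilbert space (separable or not) and let $1\le p\le 2$ be a real number. Let $B(H)$ be the Banach algebra of bounded operators on $H$, and let $S_p(H)=\{T\in B(H): \operatorname{Tr}(|T|^p)<\infty\}$ be the Schatten class, a Banach algebra under composition with the norm $\|T\|_p=(\operatorname{Tr}(|T|^p))^{1/p}$. Let $B(H)\otimes^\gamma S_p(H)$ be the Banach algebra obtained by completing the algebraic tensor product $B(H)\otimes S_p(H)$, with product determined by $(a_1\otimes b_1)(a_2\otimes b_2)=a_1a_2\otimes b_1b_2$, in the projective norm $\|u\|_\gamma=\inf\{\sum_{i=1}^n\|a_i\|\,\|b_i\|_p : u=\sum_{i=1}^n a_i\otimes b_i\}$. For a normed algebra $A$ and $a,b\in A$, $\omega\in A^*$, $f,g\in A^{**}$, put $\omega_a(b)=\omega(ab)$, ${}_a\omega(b)=\omega(ba)$, ${}_g\omega(a)=g(\omega_a)$, $\omega_f(a)=f({}_a\omega)$. The two Arens products on $A^{**}$ are $(f\,\Box\, g)(\omega)=f({}_g\omega)$ and $(f\diamond g)(\omega)=g(\omega_f)$, and $A$ is called Arens regular if $f\,\Box\, g=f\diamond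 g$ for all $f,g\in A^{**}$. Then the Banach algebra $B(H)\otimes^\gamma S_p(H)$ is not Arens regular. -/

import Mathlib

open scoped ENNReal NNReal

noncomputable section
namespace Schatten
set_option linter.unusedSectionVars false
universe u
variable {H : Type u} [NormedAddCommGroup H] [InnerProductSpace ℂ H] [CompleteSpace H]

variable (H) in
/-- The index set of a fixed orthonormal basis of `H`. -/
def basisSet : Set H := (exists_hilbertBasis ℂ H).choose

variable (H) in
/-- A fixed orthonormal basis of `H`. -/
def basis : HilbertBasis (basisSet H) ℂ H := (exists_hilbertBasis ℂ H).choose_spec.choose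

/-- The canonical trace `Tr A = ∑ᵢ ⟨A bᵢ, bᵢ⟩ ∈ [0, ∞]` of a positive operator. It does not
depend on the orthonormal basis `b`, see `trace_eq_tsum`. -/
def trace (A : H →L[ℂ] H) : ℝ≥0∞ :=
  ∑' i, ENNReal.ofReal (RCLike.re (inner ℂ (A (basis H i)) (basis H i)))

/-- The Schatten `p`-norm `‖T‖_p = (Tr |T|^p)^(1/p) ∈ [0, ∞]`. -/
def schattenENorm (p : ℝ) (T : H →L[ℂ] H) : ℝ≥0∞ :=
  trace (CFC.abs T ^ p) ^ (1 / p)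

theorem parseval {ι : Type*} (b : HilbertBasis ι ℂ H) (x : H) :
    ∑' i, ‖inner ℂ (b i) x‖ₑ ^ 2 = ‖x‖ₑ ^ 2 := by
  have h := b.hasSum_inner_mul_inner x x
  have h1 : HasSum (fun i => ‖inner ℂ (b i) x‖ ^ 2) (‖x‖ ^ 2) := by
    rw [inner_self_eq_norm_sq_to_K] at h
    have h2 : ∀ i, inner ℂ x (b i) * inner ℂ (b i) x = ((‖inner ℂ (b i) x‖ ^ 2 : ℝ) : ℂ) := by
      intro i
      rw [← inner_conj_symm, RCLike.conj_mul]; simp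
    simp only [h2] at h
    exact Complex.hasSum_ofReal.1 (by simpa using h)
  have := ENNReal.ofReal_tsum_of_nonneg (fun i => by positivity) h1.summable
  rw [h1.tsum_eq] at this
  simp only [ENNReal.ofReal_pow (norm_nonneg _), ofReal_norm] at this
  exact this.symm

theorem bessel {ι : Type*} {v : ι → H} (hv : Orthonormal ℂ v) (x : H) :
    ∑' i, ‖inner ℂ (v i) x‖ₑ ^ 2 ≤ ‖x‖ₑ ^ 2 := by
  have := ENNReal.ofReal_tsum_of_nonneg (fun i => by positivity) (hv.inner_products_summable x)
  simp only [ENNReal.ofReal_pow (norm_nonneg _), ofReal_norm] at this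
  rw [← this, ← ofReal_norm, ← ENNReal.ofReal_pow (norm_nonneg _)]
  exact ENNReal.ofReal_le_ofReal (hv.tsum_inner_products_le x)

theorem enorm_inner_comm (x y : H) : ‖inner ℂ x y‖ₑ = ‖inner ℂ y x‖ₑ := by
  rw [← ofReal_norm, ← ofReal_norm, norm_inner_symm]

theorem sum_sq_comm {ι κ : Type*} (R : H →L[ℂ] H) (hR : IsSelfAdjoint R)
    (b : HilbertBasis ι ℂ H) (c : HilbertBasis κ ℂ H) :
    ∑' i, ‖R (b i)‖ₑ ^ 2 = ∑' j, ‖R (c j)‖ₑ ^ 2 := by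
  simp_rw [← parseval c (R (b _))]
  rw [ENNReal.tsum_comm]
  refine tsum_congr fun j => ?_
  rw [← parseval b]
  refine tsum_congr fun i => ?_
  rw [enorm_inner_comm (b i)]
  congr 2
  have := hR.isSymmetric (c j) (b i)
  exact this.symm

theorem re_inner_eq {A R : H →L[ℂ] H} (hR : IsSelfAdjoint R) (h : R * R = A) (x : H) :
    ENNReal.ofReal (RCLike.re (inner ℂ (A x) x)) = ‖R x‖ₑ ^ 2 := by
  rw [← h, mul_apply_eq_comp]
  have := hR.isSymmetric (R x) x
  simp only [ContinuousLinearMap.coe_coe] at this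
  rw [this, inner_self_eq_norm_sq, ENNReal.ofReal_pow (norm_nonneg _), ofReal_norm]

theorem trace_eq_tsum {A : H →L[ℂ] H} (hA : 0 ≤ A) {ι : Type*} (b : HilbertBasis ι ℂ H) :
    trace A = ∑' i, ENNReal.ofReal (RCLike.re (inner ℂ (A (b i)) (b i))) := by
  have hR : IsSelfAdjoint (CFC.sqrt A) := IsSelfAdjoint.of_nonneg (CFC.sqrt_nonneg A)
  have h := CFC.sqrt_mul_sqrt_self A hA
  simp only [trace, re_inner_eq hR h]
  exact sum_sq_comm _ hR _ _

/-! ### Compactness -/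

theorem isCompact_of_hilbertSchmidt {ι : Type*} (R : H →L[ℂ] H) (hR : IsSelfAdjoint R)
    (b : HilbertBasis ι ℂ H) (h : ∑' i, ‖R (b i)‖ₑ ^ 2 < ∞) : IsCompactOperator R := by
  let F : Finset ι → H →L[ℂ] H := fun s =>
    ∑ i ∈ s, (innerSL ℂ (R (b i))).smulRight (b i)
  have hF : ∀ s x, F s x = ∑ i ∈ s, inner ℂ (b i) (R x) • b i := by
    intro s x
    simp only [F, sum_apply, ContinuousLinearMap.smulRight_apply,
      innerSL_apply_apply]
    refine Finset.sum_congr rfl fun i _ => ?_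
    congr 1
    exact hR.isSymmetric (b i) x
  have hFc : ∀ s, IsCompactOperator (F s) := by
    intro s
    have : F s ∈ compactOperator (RingHom.id ℂ) H H :=
      Submodule.sum_mem _ fun i _ => by
        change IsCompactOperator _
        have h1 : IsCompactOperator (innerSL ℂ (R (b i))) :=
          isCompactOperator_of_locallyCompactSpace_dom (R₁ := ℂ) (R₂ := ℂ)
            (σ₁₂ := RingHom.id ℂ) (innerSL ℂ (R (b i)))
        exact h1.clm_comp (ContinuousLinearMap.toSpanSingleton ℂ (b i))
    exact this
  refine isCompactOperator_of_tendsto (l := Filter.atTop) (F := F) ?_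
    (Filter.Eventually.of_forall hFc)
  have htail := ENNReal.tendsto_tsum_compl_atTop_zero h.ne
  have key : ∀ (s : Finset ι) (x : H),
      ‖(F s - R) x‖ₑ ^ 2 ≤ (∑' i : {i // i ∉ s}, ‖R (b i)‖ₑ ^ 2) * ‖x‖ₑ ^ 2 := by
    classical
    intro s x
    rw [← parseval b, ← ENNReal.tsum_mul_right]
    refine le_trans ?_ (tsum_subtype {i | i ∉ s} (fun i => ‖R (b i)‖ₑ ^ 2 * ‖x‖ₑ ^ 2)).ge
    refine ENNReal.tsum_le_tsum fun i => ?_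
    have h1 : inner ℂ (b i) (F s x) = if i ∈ s then inner ℂ (b i) (R x) else 0 := by
      rw [hF, inner_sum]
      simp only [inner_smul_right]
      simp [orthonormal_iff_ite.1 b.orthonormal i]
    rw [sub_apply, inner_sub_right, h1]
    by_cases hi : i ∈ s
    · simp [hi]
    · have h2 : inner ℂ (b i) (R x) = inner ℂ (R (b i)) x := (hR.isSymmetric (b i) x).symm
      simp only [hi, if_false, zero_sub, enorm_neg, h2]
      rw [Set.indicator_of_mem (by simpa using hi), ← mul_pow]
      gcongr
      rw [← ofReal_norm, ← ofReal_norm, ← ofReal_norm, ← ENNReal.ofReal_mul (norm_nonneg _)]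
      exact ENNReal.ofReal_le_ofReal (norm_inner_le_norm _ _)
  have hfin : ∀ s : Finset ι, ∑' i : {i // i ∉ s}, ‖R (b i)‖ₑ ^ 2 ≠ ∞ := fun s =>
    ne_top_of_le_ne_top h.ne (ENNReal.tsum_comp_le_tsum_of_injective Subtype.val_injective _)
  have key2 : ∀ s : Finset ι,
      ‖F s - R‖ ≤ √(∑' i : {i // i ∉ s}, ‖R (b i)‖ₑ ^ 2).toReal := by
    intro s
    refine ContinuousLinearMap.opNorm_le_bound _ (Real.sqrt_nonneg _) fun x => ?_
    refine (Real.le_sqrt (norm_nonneg _) (by positivity)).2 ?_ |>.trans_eq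
      (?_ : √((∑' i : {i // i ∉ s}, ‖R (b i)‖ₑ ^ 2).toReal * ‖x‖ ^ 2) = _)
    · have := ENNReal.toReal_mono (ENNReal.mul_ne_top (hfin s) (by simp)) (key s x)
      simpa using this
    · rw [Real.sqrt_mul ENNReal.toReal_nonneg, Real.sqrt_sq (norm_nonneg _)]
  rw [tendsto_iff_norm_sub_tendsto_zero]
  refine squeeze_zero (fun _ => norm_nonneg _) key2 ?_
  have := (ENNReal.tendsto_toReal ENNReal.zero_ne_top).comp htail
  simpa using this.sqrt

theorem isCompact_of_star_mul {A : H →L[ℂ] H}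
    (h : IsCompactOperator (star A * A : H →L[ℂ] H)) : IsCompactOperator A := by
  have h1 := (isCompactOperator_iff_isCompact_closure_image_closedBall
    ((star A * A : H →L[ℂ] H) : H →ₗ[ℂ] H) one_pos).1 h
  refine (isCompactOperator_iff_isCompact_closure_image_closedBall
    (A : H →ₗ[ℂ] H) one_pos).2 ?_
  have h2 := (h1.totallyBounded).subset subset_closure
  refine TotallyBounded.isCompact_of_isClosed ?_ isClosed_closure
  refine TotallyBounded.closure ?_
  rw [Metric.totallyBounded_iff]
  intro ε hε
  obtain ⟨t, ht, htf, hcov⟩ := Metric.finite_approx_of_totallyBounded h2 (ε ^ 2 / 4) (by positivity)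
  obtain ⟨t', ht', ht'f, rfl⟩ := Set.exists_subset_image_finite_and.1 ⟨t, ht, htf, rfl⟩
  refine ⟨A '' t', ht'f.image _, ?_⟩
  rintro _ ⟨x, hx, rfl⟩
  obtain ⟨_, ⟨x', hx', rfl⟩, hd⟩ := by simpa only [Set.mem_iUnion₂] using hcov ⟨x, hx, rfl⟩
  simp only [Set.mem_iUnion₂]
  refine ⟨A x', ⟨x', hx', rfl⟩, ?_⟩
  have hn : ‖x - x'‖ ≤ 2 := by
    have h3 := ht' hx'
    rw [mem_closedBall_zero_iff] at h3 hx
    linarith [norm_sub_le x x']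
  have hd' : ‖(star A * A) (x - x')‖ < ε ^ 2 / 4 := by
    rw [Metric.mem_ball, dist_eq_norm] at hd
    simpa using hd
  have h4 : ‖A (x - x')‖ ^ 2 ≤ ‖(star A * A) (x - x')‖ * ‖x - x'‖ := by
    have h5 : inner ℂ (star A (A (x - x'))) (x - x') = inner ℂ (A (x - x')) (A (x - x')) :=
      ContinuousLinearMap.adjoint_inner_left A (x - x') (A (x - x'))
    have h6 := norm_inner_le_norm (𝕜 := ℂ) (star A (A (x - x'))) (x - x')
    rw [h5, inner_self_eq_norm_sq_to_K] at h6
    simpa using h6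
  rw [Metric.mem_ball, dist_eq_norm]
  change ‖A x - A x'‖ < ε
  rw [← map_sub]
  refine lt_of_pow_lt_pow_left₀ 2 hε.le ?_
  nlinarith [norm_nonneg ((star A * A) (x - x'))]

theorem isCompact_of_pow {A : H →L[ℂ] H} (hA : IsSelfAdjoint A) (m : ℕ)
    (h : IsCompactOperator (A ^ 2 ^ m : H →L[ℂ] H)) : IsCompactOperator A := by
  induction m with
  | zero => simpa using h
  | succ m ih =>
    refine ih (isCompact_of_star_mul ?_)
    rwa [(hA.pow _).star_eq, ← pow_add, ← two_mul, ← pow_succ']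

/-- An operator of finite Schatten norm is compact. -/
theorem isCompact_abs {p : ℝ} (hp : 0 < p) {T : H →L[ℂ] H}
    (h : trace (CFC.abs T ^ p) < ∞) : IsCompactOperator (CFC.abs T : H →L[ℂ] H) := by
  have h0 : 0 ≤ CFC.abs T := CFC.abs_nonneg T
  have hcont : ∀ q : ℝ, 0 ≤ q → ContinuousOn (fun x : ℝ≥0 => x ^ q) (spectrum ℝ≥0 (CFC.abs T)) :=
    fun q hq => (NNReal.continuous_rpow_const hq).continuousOn
  have hmul : ∀ q r : ℝ, 0 ≤ q → 0 ≤ r →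
      CFC.abs T ^ q * CFC.abs T ^ r = CFC.abs T ^ (q + r) := by
    intro q r hq hr
    rw [CFC.rpow_def, CFC.rpow_def, CFC.rpow_def, ← cfc_mul _ _ _ (hcont q hq) (hcont r hr)]
    refine cfc_congr fun x _ => ?_
    exact (NNReal.rpow_add_of_nonneg x hq hr).symm
  have hsa : IsSelfAdjoint (CFC.abs T ^ (p / 2)) := IsSelfAdjoint.of_nonneg CFC.rpow_nonneg
  have hR : IsCompactOperator (CFC.abs T ^ (p / 2) : H →L[ℂ] H) := by
    refine isCompact_of_hilbertSchmidt _ hsa (basis H) ?_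
    simp only [← re_inner_eq hsa (hmul (p / 2) (p / 2) (by positivity) (by positivity))]
    rw [add_halves]
    exact h
  obtain ⟨m, hm⟩ := pow_unbounded_of_one_lt (p / 2) (one_lt_two)
  refine isCompact_of_pow (IsSelfAdjoint.of_nonneg h0) m ?_
  have h2 : CFC.abs T ^ 2 ^ m = CFC.abs T ^ (p / 2) * CFC.abs T ^ ((2 : ℝ) ^ m - p / 2) := by
    rw [hmul _ _ (by positivity) (by linarith), ← CFC.rpow_natCast _ _ h0]
    congr 1
    push_cast
    ring
  rw [h2]
  exact hR.comp_clm _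

/-! ### Eigenbases and singular values -/

theorem exists_eigenbasis {A : H →L[ℂ] H} (hA : IsSelfAdjoint A) (hc : IsCompactOperator A) :
    ∃ (ι : Type u) (b : HilbertBasis ι ℂ H) (s : ι → ℂ), ∀ i, A (b i) = s i • b i := by
  have hsym : (A : H →ₗ[ℂ] H).IsSymmetric := hA.isSymmetric
  have hcl : ∀ μ : ℂ, IsClosed (Module.End.eigenspace (A : H →ₗ[ℂ] H) μ : Set H) := by
    intro μ
    have : (Module.End.eigenspace (A : H →ₗ[ℂ] H) μ : Set H) = {x | A x = μ • x} := by
      ext x; simp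
    rw [this]
    exact isClosed_eq A.continuous (continuous_const_smul μ)
  have : ∀ μ : ℂ, CompleteSpace (Module.End.eigenspace (A : H →ₗ[ℂ] H) μ) :=
    fun μ => (hcl μ).completeSpace_coe
  choose w b hb using fun μ : ℂ =>
    exists_hilbertBasis ℂ (Module.End.eigenspace (A : H →ₗ[ℂ] H) μ)
  have hon : Orthonormal ℂ (fun a : Σ μ : ℂ, w μ => ((b a.1 a.2 : _) : H)) :=
    hsym.orthogonalFamily_eigenspaces.orthonormal_sigma_orthonormal
      (v_family := fun μ i => b μ i) (fun μ => (b μ).orthonormal)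
  have hbot : (Submodule.span ℂ (Set.range
      (fun a : Σ μ : ℂ, w μ => ((b a.1 a.2 : _) : H))))ᗮ = ⊥ := by
    rw [eq_bot_iff, ← ContinuousLinearMap.orthogonalComplement_iSup_eigenspaces_eq_bot hc hsym]
    intro v hv
    rw [← Submodule.iInf_orthogonal, Submodule.mem_iInf]
    intro μ
    rw [Submodule.mem_orthogonal] at hv
    have hz : ∀ i, inner ℂ ((b μ i : _) : H) v = 0 := fun i =>
      hv (b μ i) (Submodule.subset_span ⟨⟨μ, i⟩, rfl⟩)
    rw [← Submodule.orthogonalProjectionOnto_eq_zero_iff, ← enorm_eq_zero,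
      ← pow_eq_zero_iff two_ne_zero, ← parseval (b μ)]
    simp [hz]
  refine ⟨Σ μ : ℂ, w μ, HilbertBasis.mkOfOrthogonalEqBot hon hbot, fun a => a.1, fun a => ?_⟩
  rw [HilbertBasis.coe_mkOfOrthogonalEqBot]
  exact Module.End.mem_eigenspace_iff.1 (b a.1 a.2).2

theorem cfc_apply_eigenvector {A : H →L[ℂ] H} (hA : IsSelfAdjoint A) {v : H} {s : ℝ}
    (hv : A v = (s : ℂ) • v) (f : ℝ → ℝ) (hf : ContinuousOn f (spectrum ℝ A)) :
    cfc f A v = (f s : ℂ) • v := by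
  by_cases hv0 : v = 0
  · simp [hv0]
  have hs : s ∈ spectrum ℝ A := by
    rw [spectrum.mem_iff]
    intro hu
    obtain ⟨B, hB⟩ := hu.exists_left_inv
    apply hv0
    have h1 : (algebraMap ℝ (H →L[ℂ] H) s - A) v = 0 := by
      rw [sub_apply, hv, Algebra.algebraMap_eq_smul_one]
      simp
    have h2 := congrArg (fun C : H →L[ℂ] H => C v) hB
    simpa [mul_apply_eq_comp, h1] using h2.symm
  rw [cfc_apply f A hA hf]
  have main : ∀ g : C(spectrum ℝ A, ℝ), cfcHom hA g v = ((g ⟨s, hs⟩ : ℝ) : ℂ) • v := by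
    intro g
    refine ContinuousMap.induction_on_of_compact (𝕜 := ℝ)
      (p := fun g => cfcHom hA g v = ((g ⟨s, hs⟩ : ℝ) : ℂ) • v) ?_ ?_ ?_ ?_ ?_ ?_ g
    · intro r
      have : ContinuousMap.const (spectrum ℝ A) r = algebraMap ℝ C(spectrum ℝ A, ℝ) r := rfl
      rw [this, AlgHomClass.commutes, IsScalarTower.algebraMap_apply ℝ ℂ (H →L[ℂ] H),
        Algebra.algebraMap_eq_smul_one]
      rfl
    · rw [cfcHom_id]; exact hv
    · rw [show star (ContinuousMap.restrict (spectrum ℝ A) (ContinuousMap.id ℝ)) =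
        ContinuousMap.restrict (spectrum ℝ A) (ContinuousMap.id ℝ) from rfl, cfcHom_id]
      exact hv
    · intro f g hf hg
      rw [map_add, add_apply, hf, hg]
      simp [add_smul]
    · intro f g hf hg
      rw [map_mul, mul_apply_eq_comp, hg, ContinuousLinearMap.map_smul, hf, smul_smul,
        ContinuousMap.mul_apply, Complex.ofReal_mul, mul_comm]
    · intro f hfr
      have hclosed : IsClosed {g : C(spectrum ℝ A, ℝ) |
          cfcHom hA g v = ((g ⟨s, hs⟩ : ℝ) : ℂ) • v} := by
        refine isClosed_eq ?_ ?_
        · exact (ContinuousLinearMap.apply ℂ H v).continuous.comp (cfcHom_continuous hA)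
        · exact (Complex.continuous_ofReal.comp
            (continuous_eval_const _)).smul continuous_const
      exact hclosed.mem_of_frequently_of_tendsto hfr Filter.tendsto_id
  exact main _

/-- A family with `∑ |⟨vᵢ, x⟩|² ≤ ‖x‖²` for all `x`. -/
def IsBessel {ι : Type*} (v : ι → H) : Prop :=
  ∀ x, ∑' i, ‖inner ℂ (v i) x‖ₑ ^ 2 ≤ ‖x‖ₑ ^ 2

theorem IsBessel.enorm_le_one {ι : Type*} {v : ι → H} (hv : IsBessel v) (i : ι) :
    ‖v i‖ₑ ≤ 1 := by
  have h1 := (ENNReal.le_tsum i).trans (hv (v i))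
  rw [← ofReal_norm, ← ofReal_norm, ← ENNReal.ofReal_pow (norm_nonneg _),
    ← ENNReal.ofReal_pow (norm_nonneg _), inner_self_eq_norm_sq_to_K,
    ENNReal.ofReal_le_ofReal_iff (by positivity)] at h1
  rw [← ofReal_norm, ENNReal.ofReal_le_one]
  by_contra! hlt
  simp at h1
  have : 1 < ‖v i‖ ^ 2 := one_lt_pow₀ hlt two_ne_zero
  nlinarith

theorem exists_singular {T : H →L[ℂ] H} (hc : IsCompactOperator (CFC.abs T : H →L[ℂ] H)) :
    ∃ (ι : Type u) (u : HilbertBasis ι ℂ H) (s : ι → ℝ≥0) (v : ι → H),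
      (∀ i, T (u i) = (s i : ℂ) • v i) ∧ IsBessel v ∧ (∀ i, s i ≠ 0 → ‖v i‖ = 1) ∧
      ∀ p : ℝ, 0 < p → trace (CFC.abs T ^ p) = ∑' i, (s i : ℝ≥0∞) ^ p := by
  have h0 : 0 ≤ CFC.abs T := CFC.abs_nonneg T
  have hsa : IsSelfAdjoint (CFC.abs T) := IsSelfAdjoint.of_nonneg h0
  obtain ⟨ι, u, σ, hσ⟩ := exists_eigenbasis hsa hc
  have hpos := (ContinuousLinearMap.nonneg_iff_isPositive _).1 h0
  have hu : ∀ i, ‖u i‖ = 1 := u.orthonormal.1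
  have hσ' : ∀ i, ∃ r : ℝ≥0, σ i = r := by
    intro i
    have h1 := hpos.inner_nonneg_right (u i)
    rw [hσ, inner_smul_right, inner_self_eq_norm_sq_to_K, hu] at h1
    simp only [RCLike.ofReal_one, one_pow, mul_one] at h1
    refine ⟨⟨(σ i).re, (Complex.le_def.1 h1).1⟩, ?_⟩
    apply Complex.ext
    · rfl
    · simpa using (Complex.le_def.1 h1).2.symm
  choose s hs using hσ'
  simp only [hs] at hσ
  have hTT : ∀ x y, inner ℂ (T x) (T y) = inner ℂ (CFC.abs T x) (CFC.abs T y) := by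
    intro x y
    have h1 : inner ℂ (CFC.abs T x) (CFC.abs T y) = inner ℂ x ((CFC.abs T * CFC.abs T) y) :=
      hsa.isSymmetric x (CFC.abs T y)
    rw [h1, CFC.abs_mul_abs]
    exact (ContinuousLinearMap.adjoint_inner_right T x (T y)).symm
  have hin : ∀ i j, inner ℂ (T (u i)) (T (u j)) = (s i : ℂ) * (s j) * inner ℂ (u i) (u j) := by
    intro i j
    rw [hTT, hσ, hσ, inner_smul_left, inner_smul_right]
    simp [mul_assoc]
  have hnorm : ∀ i, ‖T (u i)‖ = s i := by
    intro i
    have h1 := hin i i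
    rw [inner_self_eq_norm_sq_to_K, inner_self_eq_norm_sq_to_K, hu] at h1
    have h2 : ‖T (u i)‖ ^ 2 = (s i : ℝ) ^ 2 := by
      have : ((‖T (u i)‖ ^ 2 : ℝ) : ℂ) = ((s i ^ 2 : ℝ) : ℂ) := by
        push_cast
        simpa [sq] using h1
      exact_mod_cast this
    exact (pow_left_inj₀ (norm_nonneg _) (s i).2 two_ne_zero).1 h2
  let v : ι → H := fun i => ((s i : ℂ)⁻¹) • T (u i)
  refine ⟨ι, u, s, v, fun i => ?_, ?_, fun i hi => ?_, fun p hp => ?_⟩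
  · by_cases hi : s i = 0
    · have : T (u i) = 0 := by rw [← norm_eq_zero, hnorm, hi]; rfl
      simp [this, hi]
    · simp only [v]
      rw [smul_inv_smul₀]
      exact_mod_cast hi
  · intro x
    have hon : Orthonormal ℂ (fun i : {i // s i ≠ 0} => v i) := by
      classical
      rw [orthonormal_iff_ite]
      rintro ⟨i, hi⟩ ⟨j, hj⟩
      have hi' : (s i : ℂ) ≠ 0 := by exact_mod_cast hi
      have hj' : (s j : ℂ) ≠ 0 := by exact_mod_cast hj
      simp only [v, inner_smul_left, inner_smul_right, hin, orthonormal_iff_ite.1 u.orthonormal i j,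
        Subtype.mk.injEq]
      split_ifs with h
      · simp
        field_simp
      · simp
    refine le_trans (le_of_eq ?_) (bessel hon x)
    refine (tsum_subtype_eq_of_support_subset (s := {i | s i ≠ 0})
      (f := fun i => ‖inner ℂ (v i) x‖ₑ ^ 2) ?_).symm
    intro i hi h
    apply hi
    simp only [v]
    simp [h]
  · simp only [v]
    rw [norm_smul, hnorm, norm_inv, Complex.norm_real, Real.norm_of_nonneg (NNReal.coe_nonneg _)]
    exact inv_mul_cancel₀ (by exact_mod_cast hi)
  · have hnn : 0 ≤ CFC.abs T ^ p := CFC.rpow_nonneg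
    rw [trace_eq_tsum hnn u]
    refine tsum_congr fun i => ?_
    have h1 : (CFC.abs T ^ p) (u i) = (((s i : ℝ) ^ p : ℝ) : ℂ) • u i := by
      rw [CFC.rpow_eq_cfc_real h0]
      exact cfc_apply_eigenvector hsa (hσ i) (fun x : ℝ => x ^ p)
        (Real.continuous_rpow_const hp.le).continuousOn
    rw [h1, inner_smul_left, inner_self_eq_norm_sq_to_K, hu, Complex.conj_ofReal]
    have h2 : RCLike.re ((((s i : ℝ) ^ p : ℝ) : ℂ) * ((1 : ℝ) : ℂ) ^ 2) = (s i : ℝ) ^ p := by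
      simp only [Complex.ofReal_one, one_pow, mul_one]
      exact Complex.ofReal_re _
    erw [h2]
    rw [← ENNReal.ofReal_rpow_of_nonneg (NNReal.coe_nonneg _) hp.le, ENNReal.ofReal_coe_nnreal]

/-! ### The Schatten norm as a supremum, and its norm properties -/

theorem rpow_tsum_mul_le {ι : Type*} {p : ℝ} (hp : 1 ≤ p) (w f : ι → ℝ≥0∞)
    (hw : ∑' i, w i ≤ 1) : (∑' i, w i * f i) ^ p ≤ ∑' i, w i * f i ^ p := by
  have hp0 : 0 < p := by linarith
  rw [← ENNReal.le_rpow_inv_iff hp0, ENNReal.tsum_eq_iSup_sum]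
  refine iSup_le fun t => (ENNReal.inner_le_weight_mul_Lp_of_nonneg t hp w f).trans ?_
  calc (∑ i ∈ t, w i) ^ (1 - p⁻¹) * (∑ i ∈ t, w i * f i ^ p) ^ p⁻¹
      ≤ 1 * (∑' i, w i * f i ^ p) ^ p⁻¹ := by
        gcongr
        · refine ENNReal.rpow_le_one ((ENNReal.sum_le_tsum t).trans hw) ?_
          rw [sub_nonneg]
          exact inv_le_one_of_one_le₀ hp
        · exact ENNReal.sum_le_tsum t
    _ = _ := one_mul _

theorem enorm_mul_le_half (a b : ℂ) : ‖a‖ₑ * ‖b‖ₑ ≤ 2⁻¹ * (‖a‖ₑ ^ 2 + ‖b‖ₑ ^ 2) := by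
  have h : ‖a‖₊ * ‖b‖₊ ≤ 2⁻¹ * (‖a‖₊ ^ 2 + ‖b‖₊ ^ 2) := by
    rw [← NNReal.coe_le_coe]
    push_cast
    nlinarith [sq_nonneg (‖a‖ - ‖b‖)]
  have h2 : ((2⁻¹ : ℝ≥0) : ℝ≥0∞) = 2⁻¹ := by
    rw [ENNReal.coe_inv two_ne_zero]; rfl
  rw [enorm_eq_nnnorm, enorm_eq_nnnorm, ← h2]
  exact_mod_cast h

theorem half_add_le_one {a b : ℝ≥0∞} (ha : a ≤ 1) (hb : b ≤ 1) : 2⁻¹ * (a + b) ≤ 1 := by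
  calc 2⁻¹ * (a + b) ≤ 2⁻¹ * (1 + 1) := by gcongr
    _ = 1 := by rw [one_add_one_eq_two]; exact ENNReal.inv_mul_cancel (by simp) (by simp)

theorem tsum_le_trace {p : ℝ} (hp : 1 ≤ p) {T : H →L[ℂ] H}
    (hc : IsCompactOperator (CFC.abs T : H →L[ℂ] H)) {κ : Type*} {e f : κ → H}
    (he : IsBessel e) (hf : IsBessel f) :
    ∑' k, ‖inner ℂ (f k) (T (e k))‖ₑ ^ p ≤ trace (CFC.abs T ^ p) := by
  have hp0 : 0 < p := by linarith
  obtain ⟨ι, u, s, v, hT, hv, -, htr⟩ := exists_singular hc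
  rw [htr p hp0]
  let w : κ → ι → ℝ≥0∞ := fun k i =>
    2⁻¹ * (‖inner ℂ (u i) (e k)‖ₑ ^ 2 + ‖inner ℂ (v i) (f k)‖ₑ ^ 2)
  have hrow : ∀ k, ∑' i, w k i ≤ 1 := by
    intro k
    simp only [w]
    rw [ENNReal.tsum_mul_left, ENNReal.tsum_add, parseval u]
    exact half_add_le_one (pow_le_one' (he.enorm_le_one k) 2)
      ((hv (f k)).trans (pow_le_one' (hf.enorm_le_one k) 2))
  have hcol : ∀ i, ∑' k, w k i ≤ 1 := by
    intro i
    simp only [w]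
    rw [ENNReal.tsum_mul_left, ENNReal.tsum_add]
    simp only [enorm_inner_comm (u i), enorm_inner_comm (v i)]
    refine half_add_le_one ((he (u i)).trans ?_)
      ((hf (v i)).trans (pow_le_one' (hv.enorm_le_one i) 2))
    rw [← ofReal_norm, u.orthonormal.1 i]
    simp
  have hterm : ∀ k, ‖inner ℂ (f k) (T (e k))‖ₑ ≤ ∑' i, w k i * s i := by
    intro k
    have h1 : HasSum (fun i => inner ℂ (f k) (T (inner ℂ (u i) (e k) • u i)))
        (inner ℂ (f k) (T (e k))) := by
      have h := u.hasSum_repr (e k)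
      simp only [u.repr_apply_apply] at h
      exact h.mapL ((innerSL ℂ (f k)).comp T)
    rw [← h1.tsum_eq]
    refine enorm_tsum_le_tsum_enorm.trans (ENNReal.tsum_le_tsum fun i => ?_)
    rw [map_smul, hT, inner_smul_right, inner_smul_right, enorm_mul, enorm_mul,
      enorm_inner_comm (f k)]
    have h2 : ‖((s i : ℝ) : ℂ)‖ₑ = s i := by
      rw [← ofReal_norm, Complex.norm_real, Real.norm_of_nonneg (NNReal.coe_nonneg _),
        ENNReal.ofReal_coe_nnreal]
    rw [h2, mul_left_comm, mul_comm]
    gcongr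
    exact enorm_mul_le_half _ _
  calc ∑' k, ‖inner ℂ (f k) (T (e k))‖ₑ ^ p
      ≤ ∑' k, (∑' i, w k i * s i) ^ p := by
        gcongr with k
        exact hterm k
    _ ≤ ∑' k, ∑' i, w k i * (s i : ℝ≥0∞) ^ p := by
        gcongr with k
        exact rpow_tsum_mul_le hp _ _ (hrow k)
    _ = ∑' i, (∑' k, w k i) * (s i : ℝ≥0∞) ^ p := by
        rw [ENNReal.tsum_comm]
        simp only [ENNReal.tsum_mul_right]
    _ ≤ ∑' i, (s i : ℝ≥0∞) ^ p := by
        gcongr with i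
        exact mul_le_of_le_one_left' (hcol i)

theorem exists_tsum_eq_trace {p : ℝ} (hp : 0 < p) {T : H →L[ℂ] H}
    (hc : IsCompactOperator (CFC.abs T : H →L[ℂ] H)) :
    ∃ (κ : Type u) (e f : κ → H), IsBessel e ∧ IsBessel f ∧
      trace (CFC.abs T ^ p) = ∑' k, ‖inner ℂ (f k) (T (e k))‖ₑ ^ p := by
  obtain ⟨ι, u, s, v, hT, hv, hv1, htr⟩ := exists_singular hc
  refine ⟨ι, u, v, fun x => (parseval u x).le, hv, ?_⟩
  rw [htr p hp]
  refine tsum_congr fun i => ?_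
  rw [hT, inner_smul_right]
  by_cases hi : s i = 0
  · simp [hi, hp]
  · rw [inner_self_eq_norm_sq_to_K, hv1 i hi]
    congr 1
    rw [← ofReal_norm, RCLike.ofReal_one, one_pow, mul_one, Complex.norm_real,
      Real.norm_of_nonneg (NNReal.coe_nonneg _), ENNReal.ofReal_coe_nnreal]

theorem isCompact_abs_iff {T : H →L[ℂ] H} :
    IsCompactOperator (CFC.abs T : H →L[ℂ] H) ↔ IsCompactOperator T := by
  constructor
  · intro h
    refine isCompact_of_star_mul ?_
    rw [← CFC.abs_mul_abs]
    exact h.comp_clm _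
  · intro h
    refine isCompact_of_star_mul ?_
    rw [(IsSelfAdjoint.of_nonneg (CFC.abs_nonneg T)).star_eq, CFC.abs_mul_abs]
    exact h.clm_comp (star T)

theorem trace_lt_top {p : ℝ} (hp : 0 < p) {T : H →L[ℂ] H} (h : schattenENorm p T < ∞) :
    trace (CFC.abs T ^ p) < ∞ := by
  by_contra! hlt
  rw [top_le_iff] at hlt
  rw [schattenENorm, hlt, ENNReal.top_rpow_of_pos (by positivity)] at h
  exact lt_irrefl _ h

theorem isCompact_of_schatten {p : ℝ} (hp : 0 < p) {T : H →L[ℂ] H} (h : schattenENorm p T < ∞) :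
    IsCompactOperator T :=
  isCompact_abs_iff.1 (isCompact_abs hp (trace_lt_top hp h))

theorem tsum_le_schatten {p : ℝ} (hp : 1 ≤ p) {T : H →L[ℂ] H} (hc : IsCompactOperator T)
    {κ : Type*} {e f : κ → H} (he : IsBessel e) (hf : IsBessel f) :
    (∑' k, ‖inner ℂ (f k) (T (e k))‖ₑ ^ p) ^ (1 / p) ≤ schattenENorm p T :=
  ENNReal.rpow_le_rpow (tsum_le_trace hp (isCompact_abs_iff.2 hc) he hf)
    (by positivity)

theorem exists_schatten_eq {p : ℝ} (hp : 0 < p) {T : H →L[ℂ] H} (hc : IsCompactOperator T) :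
    ∃ (κ : Type u) (e f : κ → H), IsBessel e ∧ IsBessel f ∧
      schattenENorm p T = (∑' k, ‖inner ℂ (f k) (T (e k))‖ₑ ^ p) ^ (1 / p) := by
  obtain ⟨κ, e, f, he, hf, h⟩ := exists_tsum_eq_trace hp (isCompact_abs_iff.2 hc)
  exact ⟨κ, e, f, he, hf, by rw [schattenENorm, h]⟩

theorem Lp_add_le_tsum {ι : Type*} {p : ℝ} (hp : 1 ≤ p) (f g : ι → ℝ≥0∞) :
    (∑' i, (f i + g i) ^ p) ^ (1 / p) ≤
      (∑' i, f i ^ p) ^ (1 / p) + (∑' i, g i ^ p) ^ (1 / p) := by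
  have hp0 : 0 < p := by linarith
  rw [one_div, ENNReal.rpow_inv_le_iff hp0, ENNReal.tsum_eq_iSup_sum]
  refine iSup_le fun t => ?_
  rw [← ENNReal.rpow_inv_le_iff hp0, ← one_div]
  refine (ENNReal.Lp_add_le t f g hp).trans ?_
  gcongr <;> exact ENNReal.sum_le_tsum t

theorem schattenENorm_add_le {p : ℝ} (hp : 1 ≤ p) {S T : H →L[ℂ] H}
    (hS : schattenENorm p S < ∞) (hT : schattenENorm p T < ∞) :
    schattenENorm p (S + T) ≤ schattenENorm p S + schattenENorm p T := by
  have hp0 : 0 < p := by linarith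
  have hSc := isCompact_of_schatten hp0 hS
  have hTc := isCompact_of_schatten hp0 hT
  obtain ⟨κ, e, f, he, hf, h⟩ := exists_schatten_eq hp0 (T := S + T) (hSc.add hTc)
  rw [h]
  calc _ ≤ (∑' k, (‖inner ℂ (f k) (S (e k))‖ₑ + ‖inner ℂ (f k) (T (e k))‖ₑ) ^ p) ^ (1 / p) := by
        gcongr with k
        rw [add_apply, inner_add_right]
        exact enorm_add_le _ _
    _ ≤ _ := Lp_add_le_tsum hp _ _
    _ ≤ _ := add_le_add (tsum_le_schatten hp hSc he hf) (tsum_le_schatten hp hTc he hf)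

theorem schattenENorm_zero {p : ℝ} (hp : 0 < p) : schattenENorm p (0 : H →L[ℂ] H) = 0 := by
  have h : CFC.rpow (0 : H →L[ℂ] H) p = 0 := CFC.zero_rpow hp.ne'
  rw [CFC.rpow_eq_pow] at h
  simp [schattenENorm, trace, h, hp]

theorem schattenENorm_smul_le {p : ℝ} (hp : 1 ≤ p) (c : ℂ) {T : H →L[ℂ] H}
    (hT : schattenENorm p T < ∞) : schattenENorm p (c • T) ≤ ‖c‖ₑ * schattenENorm p T := by
  have hp0 : 0 < p := by linarith
  have hTc := isCompact_of_schatten hp0 hT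
  obtain ⟨κ, e, f, he, hf, h⟩ := exists_schatten_eq hp0 (T := c • T) (hTc.smul c)
  rw [h]
  simp only [smul_apply, inner_smul_right, enorm_mul, ENNReal.mul_rpow_of_nonneg _ _ hp0.le]
  rw [ENNReal.tsum_mul_left, ENNReal.mul_rpow_of_nonneg _ _ (by positivity), one_div,
    ENNReal.rpow_rpow_inv hp0.ne', ← one_div]
  gcongr
  exact tsum_le_schatten hp hTc he hf

/-- Left ideal property: `‖A T‖_p ≤ ‖A‖ ‖T‖_p`. -/
theorem schattenENorm_mul_le {p : ℝ} (hp : 1 ≤ p) (A : H →L[ℂ] H) {T : H →L[ℂ] H}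
    (hT : schattenENorm p T < ∞) : schattenENorm p (A * T) ≤ ‖A‖ₑ * schattenENorm p T := by
  have hp0 : 0 < p := by linarith
  by_cases hA : A = 0
  · simp [hA, schattenENorm_zero hp0]
  have hA' : ‖A‖ ≠ 0 := norm_ne_zero_iff.2 hA
  have hTc := isCompact_of_schatten hp0 hT
  obtain ⟨κ, e, f, he, hf, h⟩ := exists_schatten_eq hp0 (T := A * T) (hTc.clm_comp A)
  rw [h]
  let g : κ → H := fun k => ((‖A‖ : ℂ)⁻¹) • (star A) (f k)
  have hg1 : ∀ k x, inner ℂ (f k) (A x) = ‖A‖ * inner ℂ (g k) x := by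
    intro k x
    have : (‖A‖ : ℂ) ≠ 0 := by exact_mod_cast hA'
    simp only [g]
    rw [inner_smul_left, ContinuousLinearMap.star_eq_adjoint,
      ContinuousLinearMap.adjoint_inner_left, map_inv₀, Complex.conj_ofReal, mul_inv_cancel_left₀ this]
  have hAe : ‖((‖A‖ : ℝ) : ℂ)‖ₑ = ‖A‖ₑ := by
    rw [← ofReal_norm, Complex.norm_real, norm_norm, ofReal_norm]
  have hg : IsBessel g := by
    intro x
    have h2 := hf (A x)
    simp only [hg1, enorm_mul, mul_pow, hAe] at h2
    rw [ENNReal.tsum_mul_left] at h2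
    have h3 : ‖A x‖ₑ ^ 2 ≤ ‖A‖ₑ ^ 2 * ‖x‖ₑ ^ 2 := by
      rw [← mul_pow]
      gcongr
      exact A.le_opENorm x
    exact (ENNReal.mul_le_mul_iff_right (by simpa using hA) (by simp)).1 (h2.trans h3)
  simp only [mul_apply_eq_comp, hg1, enorm_mul, ENNReal.mul_rpow_of_nonneg _ _ hp0.le, hAe]
  rw [ENNReal.tsum_mul_left, ENNReal.mul_rpow_of_nonneg _ _ (by positivity), one_div,
    ENNReal.rpow_rpow_inv hp0.ne', ← one_div]
  gcongr
  exact tsum_le_schatten hp hTc he hg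

theorem enorm_le_schattenENorm {p : ℝ} (hp : 1 ≤ p) {T : H →L[ℂ] H}
    (hT : schattenENorm p T < ∞) : ‖T‖ₑ ≤ schattenENorm p T := by
  have hp0 : 0 < p := by linarith
  have hTc := isCompact_of_schatten hp0 hT
  have hB : ∀ x : H, ‖x‖ = 1 → IsBessel (fun _ : Unit => x) := by
    intro x hx y
    simp only [tsum_fintype, Finset.univ_unique, Finset.sum_singleton]
    gcongr
    rw [← ofReal_norm, ← ofReal_norm]
    refine ENNReal.ofReal_le_ofReal ?_
    simpa [hx] using norm_inner_le_norm (𝕜 := ℂ) x y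
  have h1 : ∀ x y : H, ‖x‖ = 1 → ‖y‖ = 1 → ‖inner ℂ y (T x)‖ ≤ (schattenENorm p T).toReal := by
    intro x y hx hy
    have h2 := tsum_le_schatten hp hTc (hB x hx) (hB y hy)
    simp only [tsum_fintype, Finset.univ_unique, Finset.sum_singleton, one_div,
      ENNReal.rpow_rpow_inv hp0.ne'] at h2
    simpa using ENNReal.toReal_mono hT.ne h2
  have h3 : ‖T‖ ≤ (schattenENorm p T).toReal := by
    refine ContinuousLinearMap.opNorm_le_of_unit_norm ENNReal.toReal_nonneg fun x hx => ?_
    by_cases hz : T x = 0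
    · simp [hz]
    have hz' : ‖T x‖ ≠ 0 := norm_ne_zero_iff.2 hz
    have h4 := h1 x ((‖T x‖ : ℂ)⁻¹ • T x) hx (by simp [norm_smul, hz'])
    rw [inner_smul_left, inner_self_eq_norm_sq_to_K, norm_mul, norm_pow] at h4
    simp only [map_inv₀, Complex.conj_ofReal, norm_inv, Complex.norm_real, norm_norm] at h4
    have h5 : ‖((‖T x‖ : ℝ) : ℂ)‖ = ‖T x‖ := by rw [Complex.norm_real, norm_norm]
    have h6 : ‖T x‖⁻¹ * ‖T x‖ ^ 2 = ‖T x‖ := by field_simp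
    rw [← h6]
    refine le_trans (le_of_eq ?_) h4
    congr 2
    exact h5.symm
  rw [← ofReal_norm]
  exact ENNReal.ofReal_le_of_le_toReal h3
end Schatten

/-! ### The Banach algebra `S_p(H)` -/

section SchattenClass

variable (p : ℝ) [Fact (1 ≤ p)]
  (H : Type*) [NormedAddCommGroup H] [InnerProductSpace ℂ H] [CompleteSpace H]

/-- The operators `T ∈ B(H)` with `‖T‖_p < ∞`, as a subalgebra of `B(H)`. -/
def schattenSubalgebra : NonUnitalSubalgebra ℂ (H →L[ℂ] H) where
  carrier := {T | Schatten.schattenENorm p T < ∞}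
  add_mem' hS hT := (Schatten.schattenENorm_add_le Fact.out hS hT).trans_lt
    (ENNReal.add_lt_top.2 ⟨hS, hT⟩)
  zero_mem' := by
    have hp : (1 : ℝ) ≤ p := Fact.out
    change Schatten.schattenENorm p 0 < ∞
    rw [Schatten.schattenENorm_zero (by linarith)]
    exact ENNReal.zero_lt_top
  mul_mem' {S T} _ hT := (Schatten.schattenENorm_mul_le Fact.out S hT).trans_lt
    (ENNReal.mul_lt_top enorm_lt_top hT)
  smul_mem' c _ hT := (Schatten.schattenENorm_smul_le Fact.out c hT).trans_lt
    (ENNReal.mul_lt_top enorm_lt_top hT)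

/-- The Schatten class `S_p(H)`, with composition as product and the Schatten `p`-norm. -/
def SchattenClass : Type _ := schattenSubalgebra p H

namespace SchattenClass

instance : NonUnitalRing (SchattenClass p H) := inferInstanceAs (NonUnitalRing (schattenSubalgebra p H))
instance : Module ℂ (SchattenClass p H) := inferInstanceAs (Module ℂ (schattenSubalgebra p H))
instance : IsScalarTower ℂ (SchattenClass p H) (SchattenClass p H) :=
  inferInstanceAs (IsScalarTower ℂ (schattenSubalgebra p H) (schattenSubalgebra p H))
instance : SMulCommClass ℂ (SchattenClass p H) (SchattenClass p H) :=
  inferInstanceAs (SMulCommClass ℂ (schattenSubalgebra p H) (schattenSubalgebra p H))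

instance : Norm (SchattenClass p H) := ⟨fun T => (Schatten.schattenENorm p T.1).toReal⟩

variable {p H}

theorem norm_def (T : SchattenClass p H) : ‖T‖ = (Schatten.schattenENorm p T.1).toReal := rfl

theorem ofReal_norm (T : SchattenClass p H) :
    ENNReal.ofReal ‖T‖ = Schatten.schattenENorm p T.1 :=
  ENNReal.ofReal_toReal T.2.ne

theorem opNorm_le (T : SchattenClass p H) : ‖T.1‖ ≤ ‖T‖ := by
  have h := Schatten.enorm_le_schattenENorm (p := p) Fact.out T.2
  rw [norm_def]
  simpa using ENNReal.toReal_mono T.2.ne h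

theorem norm_smul_le' (c : ℂ) (T : SchattenClass p H) : ‖c • T‖ ≤ ‖c‖ * ‖T‖ := by
  have h := Schatten.schattenENorm_smul_le (p := p) Fact.out c T.2
  have h2 := ENNReal.toReal_mono (ENNReal.mul_ne_top enorm_ne_top T.2.ne) h
  rwa [ENNReal.toReal_mul, toReal_enorm] at h2

theorem norm_add_le' (S T : SchattenClass p H) : ‖S + T‖ ≤ ‖S‖ + ‖T‖ := by
  have h := Schatten.schattenENorm_add_le (p := p) Fact.out S.2 T.2
  have h2 := ENNReal.toReal_mono (ENNReal.add_ne_top.2 ⟨S.2.ne, T.2.ne⟩) h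
  rwa [ENNReal.toReal_add S.2.ne T.2.ne] at h2

theorem norm_mul_le' (S T : SchattenClass p H) : ‖S * T‖ ≤ ‖S‖ * ‖T‖ := by
  have h := Schatten.schattenENorm_mul_le (p := p) Fact.out S.1 T.2
  have h2 := ENNReal.toReal_mono (ENNReal.mul_ne_top enorm_ne_top T.2.ne) h
  rw [ENNReal.toReal_mul, toReal_enorm] at h2
  exact h2.trans (mul_le_mul_of_nonneg_right (opNorm_le S) ENNReal.toReal_nonneg)

variable (p H) in
/-- The Schatten `p`-norm as a group norm. -/
def addGroupNorm : AddGroupNorm (SchattenClass p H) where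
  toFun T := ‖T‖
  map_zero' := by
    have h := norm_smul_le' (0 : ℂ) (0 : SchattenClass p H)
    rw [zero_smul, norm_zero, zero_mul] at h
    exact le_antisymm h ENNReal.toReal_nonneg
  add_le' := norm_add_le'
  neg' T := by
    have h : ∀ S : SchattenClass p H, ‖-S‖ ≤ ‖S‖ := fun S => by
      simpa using norm_smul_le' (-1 : ℂ) S
    exact le_antisymm (h T) (by simpa using h (-T))
  eq_zero_of_map_eq_zero' T hT := by
    have h := opNorm_le T
    rw [hT] at h
    exact Subtype.ext (norm_le_zero_iff.1 h)

instance : NormedAddCommGroup (SchattenClass p H) :=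
  (addGroupNorm p H).toNormedAddCommGroup

instance : NonUnitalNormedRing (SchattenClass p H) where
  __ := (inferInstance : NormedAddCommGroup (SchattenClass p H))
  __ := (inferInstance : NonUnitalRing (SchattenClass p H))
  norm_mul_le := norm_mul_le'

instance : NormedSpace ℂ (SchattenClass p H) where
  norm_smul_le := norm_smul_le'

end SchattenClass

end SchattenClass

/-! ### The projective tensor product of Banach algebras -/

section Projective

open scoped TensorProduct

variable (A B : Type*)
  [NonUnitalNormedRing A] [NormedSpace ℂ A] [IsScalarTower ℂ A A] [SMulCommClass ℂ A A]
  [NonUnitalNormedRing B] [NormedSpace ℂ B] [IsScalarTower ℂ B B] [SMulCommClass ℂ B B]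

/-- The algebraic tensor product `A ⊗ B`, with the product
`(a₁ ⊗ b₁) (a₂ ⊗ b₂) = a₁ a₂ ⊗ b₁ b₂`; it carries the projective norm. -/
def AlgTensor : Type _ := A ⊗[ℂ] B

namespace AlgTensor

instance : NonUnitalRing (AlgTensor A B) := inferInstanceAs (NonUnitalRing (A ⊗[ℂ] B))
instance : Module ℂ (AlgTensor A B) := inferInstanceAs (Module ℂ (A ⊗[ℂ] B))
instance : IsScalarTower ℂ (AlgTensor A B) (AlgTensor A B) :=
  inferInstanceAs (IsScalarTower ℂ (A ⊗[ℂ] B) (A ⊗[ℂ] B))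
instance : SMulCommClass ℂ (AlgTensor A B) (AlgTensor A B) :=
  inferInstanceAs (SMulCommClass ℂ (A ⊗[ℂ] B) (A ⊗[ℂ] B))

variable {A B}

/-- The elementary tensor `a ⊗ b`. -/
def tmul (a : A) (b : B) : AlgTensor A B := a ⊗ₜ[ℂ] b

theorem tmul_mul_tmul (a a' : A) (b b' : B) :
    tmul a b * tmul a' b' = tmul (a * a') (b * b') :=
  Algebra.TensorProduct.tmul_mul_tmul a a' b b'

/-- The values `∑ ‖aᵢ‖ ‖bᵢ‖` over all representations `u = ∑ aᵢ ⊗ bᵢ`. -/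
def costs (u : AlgTensor A B) : Set ℝ :=
  {r | ∃ (n : ℕ) (a : Fin n → A) (b : Fin n → B),
    u = ∑ i, tmul (a i) (b i) ∧ r = ∑ i, ‖a i‖ * ‖b i‖}

/-- The projective norm. -/
instance : Norm (AlgTensor A B) := ⟨fun u => sInf (costs u)⟩

theorem norm_def (u : AlgTensor A B) : ‖u‖ = sInf (costs u) := rfl

theorem costs_nonneg {u : AlgTensor A B} {r : ℝ} (hr : r ∈ costs u) : 0 ≤ r := by
  obtain ⟨n, a, b, -, rfl⟩ := hr
  positivity

theorem norm_le {u : AlgTensor A B} {r : ℝ} (hr : r ∈ costs u) : ‖u‖ ≤ r :=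
  csInf_le ⟨0, fun _ => costs_nonneg⟩ hr

theorem costs_zero : (0 : ℝ) ∈ costs (0 : AlgTensor A B) :=
  ⟨0, Fin.elim0, Fin.elim0, by simp, by simp⟩

theorem costs_tmul (a : A) (b : B) : ‖a‖ * ‖b‖ ∈ costs (tmul a b) :=
  ⟨1, fun _ => a, fun _ => b, by simp, by simp⟩

theorem costs_add {u v : AlgTensor A B} {r s : ℝ} (hr : r ∈ costs u) (hs : s ∈ costs v) :
    r + s ∈ costs (u + v) := by
  obtain ⟨n, a, b, rfl, rfl⟩ := hr
  obtain ⟨m, a', b', rfl, rfl⟩ := hs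
  exact ⟨n + m, Fin.append a a', Fin.append b b', by simp [Fin.sum_univ_add],
    by simp [Fin.sum_univ_add]⟩

theorem costs_sum {n : ℕ} {u : Fin n → AlgTensor A B} {r : Fin n → ℝ}
    (h : ∀ i, r i ∈ costs (u i)) : ∑ i, r i ∈ costs (∑ i, u i) := by
  induction n with
  | zero => simpa using costs_zero
  | succ n ih =>
    rw [Fin.sum_univ_succ, Fin.sum_univ_succ]
    exact costs_add (h 0) (ih fun i => h i.succ)

theorem costs_smul (c : ℂ) {u : AlgTensor A B} {r : ℝ} (hr : r ∈ costs u) :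
    ‖c‖ * r ∈ costs (c • u) := by
  obtain ⟨n, a, b, rfl, rfl⟩ := hr
  refine ⟨n, fun i => c • a i, b, ?_, ?_⟩
  · rw [Finset.smul_sum]
    exact Finset.sum_congr rfl fun i _ => TensorProduct.smul_tmul' c (a i) (b i)
  · simp only [norm_smul, mul_assoc, Finset.mul_sum]

theorem costs_mul {u v : AlgTensor A B} {r s : ℝ} (hr : r ∈ costs u) (hs : s ∈ costs v) :
    ∃ t ≤ r * s, t ∈ costs (u * v) := by
  obtain ⟨n, a, b, rfl, rfl⟩ := hr
  obtain ⟨m, a', b', rfl, rfl⟩ := hs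
  refine ⟨∑ i, ∑ j, ‖a i * a' j‖ * ‖b i * b' j‖, ?_, ?_⟩
  · rw [Finset.sum_mul_sum]
    refine Finset.sum_le_sum fun i _ => Finset.sum_le_sum fun j _ => ?_
    calc ‖a i * a' j‖ * ‖b i * b' j‖ ≤ (‖a i‖ * ‖a' j‖) * (‖b i‖ * ‖b' j‖) := by
          gcongr <;> exact norm_mul_le _ _
      _ = _ := by ring
  · rw [Finset.sum_mul_sum]
    exact costs_sum fun i => costs_sum fun j => by
      rw [tmul_mul_tmul]
      exact costs_tmul _ _

theorem costs_nonempty (u : AlgTensor A B) : (costs u).Nonempty := by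
  refine TensorProduct.induction_on u ⟨0, costs_zero⟩ (fun a b => ⟨_, costs_tmul a b⟩) ?_
  rintro u v ⟨r, hr⟩ ⟨s, hs⟩
  exact ⟨_, costs_add hr hs⟩

theorem norm_nonneg' (u : AlgTensor A B) : 0 ≤ ‖u‖ :=
  Real.sInf_nonneg fun _ => costs_nonneg

theorem exists_cost_lt (u : AlgTensor A B) {ε : ℝ} (hε : 0 < ε) : ∃ r ∈ costs u, r < ‖u‖ + ε :=
  exists_lt_of_csInf_lt (costs_nonempty u) (lt_add_of_pos_right _ hε)

theorem norm_add_le' (u v : AlgTensor A B) : ‖u + v‖ ≤ ‖u‖ + ‖v‖ := by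
  refine le_of_forall_pos_le_add fun ε hε => ?_
  obtain ⟨r, hr, hr'⟩ := exists_cost_lt u (half_pos hε)
  obtain ⟨s, hs, hs'⟩ := exists_cost_lt v (half_pos hε)
  linarith [norm_le (costs_add hr hs)]

theorem norm_smul_le' (c : ℂ) (u : AlgTensor A B) : ‖c • u‖ ≤ ‖c‖ * ‖u‖ := by
  refine le_of_forall_pos_le_add fun ε hε => ?_
  obtain ⟨r, hr, hr'⟩ := exists_cost_lt u (ε := ε / (‖c‖ + 1)) (by positivity)
  have h1 := norm_le (costs_smul c hr)
  have h2 : ‖c‖ * (ε / (‖c‖ + 1)) ≤ ε := by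
    rw [mul_div_assoc', div_le_iff₀ (by positivity)]
    nlinarith [norm_nonneg c]
  nlinarith [norm_nonneg c]

theorem norm_mul_le' (u v : AlgTensor A B) : ‖u * v‖ ≤ ‖u‖ * ‖v‖ := by
  have key : ∀ r ∈ costs u, ∀ s ∈ costs v, ‖u * v‖ ≤ r * s := fun r hr s hs => by
    obtain ⟨t, ht, ht'⟩ := costs_mul hr hs
    exact (norm_le ht').trans ht
  have h1 : ∀ r ∈ costs u, ‖u * v‖ ≤ r * ‖v‖ := by
    intro r hr
    refine ge_of_tendsto (x := nhdsWithin (0 : ℝ) (Set.Ioi 0)) (f := fun ε => r * (‖v‖ + ε)) ?_ ?_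
    · refine Filter.Tendsto.mono_left ?_ nhdsWithin_le_nhds
      exact Continuous.tendsto' (by fun_prop) _ _ (by simp)
    · filter_upwards [self_mem_nhdsWithin] with ε hε
      obtain ⟨s, hs, hs'⟩ := exists_cost_lt v hε
      exact (key r hr s hs).trans (mul_le_mul_of_nonneg_left hs'.le (costs_nonneg hr))
  refine ge_of_tendsto (x := nhdsWithin (0 : ℝ) (Set.Ioi 0)) (f := fun ε => (‖u‖ + ε) * ‖v‖) ?_ ?_
  · refine Filter.Tendsto.mono_left ?_ nhdsWithin_le_nhds
    exact Continuous.tendsto' (by fun_prop) _ _ (by simp)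
  · filter_upwards [self_mem_nhdsWithin] with ε hε
    obtain ⟨r, hr, hr'⟩ := exists_cost_lt u hε
    exact (h1 r hr).trans (mul_le_mul_of_nonneg_right hr'.le (norm_nonneg' v))

variable (A B) in
/-- The projective norm as a group seminorm. -/
def addGroupSeminorm : AddGroupSeminorm (AlgTensor A B) where
  toFun u := ‖u‖
  map_zero' := le_antisymm (norm_le costs_zero) (norm_nonneg' _)
  add_le' := norm_add_le'
  neg' u := by
    have h : ∀ v : AlgTensor A B, ‖-v‖ ≤ ‖v‖ := fun v => by
      simpa using norm_smul_le' (-1 : ℂ) v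
    exact le_antisymm (h u) (by simpa using h (-u))

instance : SeminormedAddCommGroup (AlgTensor A B) :=
  (addGroupSeminorm A B).toSeminormedAddCommGroup

instance : NonUnitalSeminormedRing (AlgTensor A B) where
  __ := (inferInstance : SeminormedAddCommGroup (AlgTensor A B))
  __ := (inferInstance : NonUnitalRing (AlgTensor A B))
  norm_mul_le := norm_mul_le'

instance : NormedSpace ℂ (AlgTensor A B) where
  norm_smul_le := norm_smul_le'

end AlgTensor

/-- The projective tensor product `A ⊗^γ B`: the completion of `A ⊗ B` in the projective norm. -/
def ProjectiveTensorProduct : Type _ := UniformSpace.Completion (AlgTensor A B)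

namespace ProjectiveTensorProduct

instance : NormedAddCommGroup (ProjectiveTensorProduct A B) :=
  inferInstanceAs (NormedAddCommGroup (UniformSpace.Completion (AlgTensor A B)))
instance : NormedSpace ℂ (ProjectiveTensorProduct A B) :=
  inferInstanceAs (NormedSpace ℂ (UniformSpace.Completion (AlgTensor A B)))
instance : CompleteSpace (ProjectiveTensorProduct A B) :=
  inferInstanceAs (CompleteSpace (UniformSpace.Completion (AlgTensor A B)))

/-- The canonical map `A ⊗ B → A ⊗^γ B`. -/
def ofAlg : AlgTensor A B →L[ℂ] ProjectiveTensorProduct A B :=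
  UniformSpace.Completion.toComplL

variable {A B}

theorem norm_ofAlg (u : AlgTensor A B) : ‖ofAlg A B u‖ = ‖u‖ := UniformSpace.Completion.norm_coe u

theorem denseRange_ofAlg : DenseRange (ofAlg A B) := UniformSpace.Completion.denseRange_coe

theorem isDenseInducing_ofAlg : IsDenseInducing (ofAlg A B) :=
  UniformSpace.Completion.isDenseInducing_coe

theorem ofAlg_zero : ofAlg A B 0 = 0 := ContinuousLinearMap.map_zero _

theorem ofAlg_add (u v : AlgTensor A B) : ofAlg A B (u + v) = ofAlg A B u + ofAlg A B v :=
  ContinuousLinearMap.map_add _ u v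

theorem ofAlg_smul (c : ℂ) (u : AlgTensor A B) : ofAlg A B (c • u) = c • ofAlg A B u :=
  ContinuousLinearMap.map_smul _ c u

/-- The product of `A ⊗^γ B` is the continuous extension of the product of `A ⊗ B`. -/
instance : Mul (ProjectiveTensorProduct A B) where
  mul x y := (isDenseInducing_ofAlg.prodMap isDenseInducing_ofAlg).extend
    (fun q : AlgTensor A B × AlgTensor A B => ofAlg A B (q.1 * q.2)) (x, y)

theorem ofAlg_mul (u v : AlgTensor A B) : ofAlg A B (u * v) = ofAlg A B u * ofAlg A B v :=
  ((isDenseInducing_ofAlg.prodMap isDenseInducing_ofAlg).extend_eq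
    (f := fun q : AlgTensor A B × AlgTensor A B => ofAlg A B (q.1 * q.2))
    ((ofAlg A B).continuous.comp continuous_mul) (u, v)).symm

theorem continuous_mul' :
    Continuous (fun q : ProjectiveTensorProduct A B × ProjectiveTensorProduct A B => q.1 * q.2) := by
  let m := (AddMonoidHom.mul : AlgTensor A B →+ AlgTensor A B →+ AlgTensor A B).compr₂
    UniformSpace.Completion.toCompl
  have : Continuous fun q : AlgTensor A B × AlgTensor A B => m q.1 q.2 :=
    (UniformSpace.Completion.continuous_coe _).comp continuous_mul
  have di : IsDenseInducing
      (UniformSpace.Completion.toCompl : AlgTensor A B → UniformSpace.Completion (AlgTensor A B)) :=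
    UniformSpace.Completion.isDenseInducing_coe
  exact (di.extend_Z_bilin di this :)

theorem cont_mul {X : Type*} [TopologicalSpace X] {f g : X → ProjectiveTensorProduct A B}
    (hf : Continuous f) (hg : Continuous g) : Continuous fun x => f x * g x :=
  continuous_mul'.comp (hf.prodMk hg)

/-- Two continuous maps that agree on `A ⊗ B` are equal. -/
theorem eq_of_cont {X : Type*} [TopologicalSpace X] [T2Space X]
    {f g : ProjectiveTensorProduct A B → X} (hf : Continuous f) (hg : Continuous g)
    (h : ∀ u, f (ofAlg A B u) = g (ofAlg A B u)) (x : ProjectiveTensorProduct A B) : f x = g x :=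
  congrFun (denseRange_ofAlg.equalizer hf hg (funext h)) x

theorem mul_assoc' (x y z : ProjectiveTensorProduct A B) : x * y * z = x * (y * z) := by
  refine eq_of_cont (f := fun x => x * y * z) (g := fun x => x * (y * z))
    (cont_mul (cont_mul continuous_id continuous_const) continuous_const)
    (cont_mul continuous_id continuous_const) (fun u => ?_) x
  refine eq_of_cont (f := fun y => ofAlg A B u * y * z) (g := fun y => ofAlg A B u * (y * z))
    (cont_mul (cont_mul continuous_const continuous_id) continuous_const)
    (cont_mul continuous_const (cont_mul continuous_id continuous_const)) (fun v => ?_) y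
  refine eq_of_cont (f := fun z => ofAlg A B u * ofAlg A B v * z)
    (g := fun z => ofAlg A B u * (ofAlg A B v * z))
    (cont_mul continuous_const continuous_id)
    (cont_mul continuous_const (cont_mul continuous_const continuous_id)) (fun w => ?_) z
  simp only [← ofAlg_mul, mul_assoc]

theorem add_mul' (x y z : ProjectiveTensorProduct A B) : (x + y) * z = x * z + y * z := by
  refine eq_of_cont (f := fun x => (x + y) * z) (g := fun x => x * z + y * z)
    (cont_mul (continuous_id.add continuous_const) continuous_const)
    ((cont_mul continuous_id continuous_const).add continuous_const) (fun u => ?_) x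
  refine eq_of_cont (f := fun y => (ofAlg A B u + y) * z) (g := fun y => ofAlg A B u * z + y * z)
    (cont_mul (continuous_const.add continuous_id) continuous_const)
    (continuous_const.add (cont_mul continuous_id continuous_const)) (fun v => ?_) y
  refine eq_of_cont (f := fun z => (ofAlg A B u + ofAlg A B v) * z)
    (g := fun z => ofAlg A B u * z + ofAlg A B v * z)
    (cont_mul continuous_const continuous_id)
    ((cont_mul continuous_const continuous_id).add (cont_mul continuous_const continuous_id))
    (fun w => ?_) z
  simp only [← ofAlg_mul, ← ofAlg_add, add_mul]

theorem mul_add' (z x y : ProjectiveTensorProduct A B) : z * (x + y) = z * x + z * y := by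
  refine eq_of_cont (f := fun x => z * (x + y)) (g := fun x => z * x + z * y)
    (cont_mul continuous_const (continuous_id.add continuous_const))
    ((cont_mul continuous_const continuous_id).add continuous_const) (fun u => ?_) x
  refine eq_of_cont (f := fun y => z * (ofAlg A B u + y)) (g := fun y => z * ofAlg A B u + z * y)
    (cont_mul continuous_const (continuous_const.add continuous_id))
    (continuous_const.add (cont_mul continuous_const continuous_id)) (fun v => ?_) y
  refine eq_of_cont (f := fun z => z * (ofAlg A B u + ofAlg A B v))
    (g := fun z => z * ofAlg A B u + z * ofAlg A B v)
    (cont_mul continuous_id continuous_const)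
    ((cont_mul continuous_id continuous_const).add (cont_mul continuous_id continuous_const))
    (fun w => ?_) z
  simp only [← ofAlg_mul, ← ofAlg_add, mul_add]

theorem smul_mul' (c : ℂ) (x y : ProjectiveTensorProduct A B) : c • x * y = c • (x * y) := by
  refine eq_of_cont (f := fun x => c • x * y) (g := fun x => c • (x * y))
    (cont_mul (continuous_const_smul c) continuous_const)
    ((cont_mul continuous_id continuous_const).const_smul c) (fun u => ?_) x
  refine eq_of_cont (f := fun y => c • ofAlg A B u * y) (g := fun y => c • (ofAlg A B u * y))
    (cont_mul continuous_const continuous_id)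
    ((cont_mul continuous_const continuous_id).const_smul c) (fun v => ?_) y
  simp only [← ofAlg_smul, ← ofAlg_mul, smul_mul_assoc]

theorem mul_smul' (c : ℂ) (x y : ProjectiveTensorProduct A B) : x * c • y = c • (x * y) := by
  refine eq_of_cont (f := fun x => x * c • y) (g := fun x => c • (x * y))
    (cont_mul continuous_id continuous_const)
    ((cont_mul continuous_id continuous_const).const_smul c) (fun u => ?_) x
  refine eq_of_cont (f := fun y => ofAlg A B u * c • y) (g := fun y => c • (ofAlg A B u * y))
    (cont_mul continuous_const (continuous_const_smul c))
    ((cont_mul continuous_const continuous_id).const_smul c) (fun v => ?_) y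
  simp only [← ofAlg_smul, ← ofAlg_mul, mul_smul_comm]

theorem norm_mul_le' (x y : ProjectiveTensorProduct A B) : ‖x * y‖ ≤ ‖x‖ * ‖y‖ := by
  refine denseRange_ofAlg.induction_on (p := fun x => ‖x * y‖ ≤ ‖x‖ * ‖y‖) x
    (isClosed_le (cont_mul continuous_id continuous_const).norm
      (continuous_norm.mul continuous_const)) fun u => ?_
  refine denseRange_ofAlg.induction_on
    (p := fun y => ‖ofAlg A B u * y‖ ≤ ‖ofAlg A B u‖ * ‖y‖) y
    (isClosed_le (cont_mul continuous_const continuous_id).norm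
      (continuous_const.mul continuous_norm)) fun v => ?_
  rw [← ofAlg_mul, norm_ofAlg, norm_ofAlg, norm_ofAlg]
  exact norm_mul_le u v

instance : NonUnitalNormedRing (ProjectiveTensorProduct A B) where
  __ := (inferInstance : NormedAddCommGroup (ProjectiveTensorProduct A B))
  __ := (inferInstance : Mul (ProjectiveTensorProduct A B))
  zero_mul x := by simpa using smul_mul' (0 : ℂ) (0 : ProjectiveTensorProduct A B) x
  mul_zero x := by simpa using mul_smul' (0 : ℂ) x (0 : ProjectiveTensorProduct A B)
  left_distrib := mul_add'
  right_distrib := add_mul'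
  mul_assoc := mul_assoc'
  norm_mul_le := norm_mul_le'

instance : IsScalarTower ℂ (ProjectiveTensorProduct A B) (ProjectiveTensorProduct A B) :=
  ⟨smul_mul'⟩

instance : SMulCommClass ℂ (ProjectiveTensorProduct A B) (ProjectiveTensorProduct A B) :=
  ⟨fun c x y => (mul_smul' c x y).symm⟩

end ProjectiveTensorProduct

end Projective

/-! ### Arens products and Arens regularity -/

section Arens

open ContinuousLinearMap

variable {A : Type*} [NonUnitalNormedRing A] [NormedSpace ℂ A] [IsScalarTower ℂ A A]
  [SMulCommClass ℂ A A]

/-- The bounded map `ω ↦ (a ↦ ω_a)`, where `ω_a(b) = ω(a b)`. -/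
def arensLeft : StrongDual ℂ A →L[ℂ] A →L[ℂ] StrongDual ℂ A :=
  ((compL ℂ A (A →L[ℂ] A) (StrongDual ℂ A)).flip (mul ℂ A)).comp (compL ℂ A A ℂ)

/-- The bounded map `ω ↦ (a ↦ ₐω)`, where `ₐω(b) = ω(b a)`. -/
def arensRight : StrongDual ℂ A →L[ℂ] A →L[ℂ] StrongDual ℂ A :=
  ((compL ℂ A (A →L[ℂ] A) (StrongDual ℂ A)).flip (mul ℂ A).flip).comp (compL ℂ A A ℂ)

theorem arensLeft_apply (ω : StrongDual ℂ A) (a b : A) : arensLeft ω a b = ω (a * b) := rfl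

theorem arensRight_apply (ω : StrongDual ℂ A) (a b : A) : arensRight ω a b = ω (b * a) := rfl

/-- The first Arens product `(f □ g)(ω) = f(_gω)`, where `_gω(a) = g(ω_a)`. -/
def arensBox (f g : StrongDual ℂ (StrongDual ℂ A)) : StrongDual ℂ (StrongDual ℂ A) :=
  f.comp ((compL ℂ A (StrongDual ℂ A) ℂ g).comp arensLeft)

/-- The second Arens product `(f ◇ g)(ω) = g(ω_f)`, where `ω_f(a) = f(ₐω)`. -/
def arensDiamond (f g : StrongDual ℂ (StrongDual ℂ A)) : StrongDual ℂ (StrongDual ℂ A) :=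
  g.comp ((compL ℂ A (StrongDual ℂ A) ℂ f).comp arensRight)

theorem arensBox_apply (f g : StrongDual ℂ (StrongDual ℂ A)) (ω : StrongDual ℂ A) :
    arensBox f g ω = f (g.comp (arensLeft ω)) := rfl

theorem arensDiamond_apply (f g : StrongDual ℂ (StrongDual ℂ A)) (ω : StrongDual ℂ A) :
    arensDiamond f g ω = g (f.comp (arensRight ω)) := rfl

variable (A) in
/-- `A` is Arens regular if the two Arens products on `A**` agree. -/
def IsArensRegular : Prop :=
  ∀ f g : StrongDual ℂ (StrongDual ℂ A), arensBox f g = arensDiamond f g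

end Arens

end

/-! Arens regularity fails as soon as a bounded functional `ω` and two bounded sequences `x i`, `y
j` satisfy `ω (x i * y j) = 1` for `i ≤ j` and `0` otherwise. The two Arens products of weak-*
cluster points of the sequences are the iterated limits of this matrix in the two orders, namely 1
and 0 (`not_isArensRegular_of_iteratedLimits`).

To realise the matrix, take an orthonormal family `e` indexed by `ℕ × ℕ` and write `E k l` for the
rank-one operator sending `e (0, l)` to `e (0, k)`. Let `a i` be a contraction carrying row 0 of the
family to row `i`, and put `x i = a i ⊗ E i 0`, `y j = E j 0 ⊗ E 0 j`. The product is `a i * E j 0 ⊗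
E i j`. Its first factor sends `e (0, 0)` to `e (i, j)`, and its second is a matrix unit, so both
legs record the pair `(i, j)`, each as a unit vector of `ℓ²(ℕ × ℕ)`.

The functional pairs these two `ℓ²` vectors: the coordinates of `T (e (0, 0))` against the matrix
coefficients of `S`, truncated to the triangle `k ≤ l`. The truncation only drops terms, so it costs
nothing in an `ℓ²` estimate. By Cauchy–Schwarz the form is bounded by `‖T‖` times the
Hilbert–Schmidt norm of `S`, which is at most `‖S‖_p` because `p ≤ 2`
(`Schatten.tsum_enorm_inner_sq_le`). A bounded bilinear form is a functional on the projective
tensor product (`ProjectiveTensorProduct.exists_functional`). -/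

/-! ### Iterated limits and the Arens products -/

section Criterion

open Filter Topology

/-- A bounded sequence in a normed space has a limit in the bidual along any ultrafilter,
in the weak-* sense. -/
theorem exists_bidual_ultrafilter_limit {X : Type*} [NormedAddCommGroup X] [NormedSpace ℂ X]
    (U : Ultrafilter ℕ) (x : ℕ → X) {C : ℝ} (hx : ∀ i, ‖x i‖ ≤ C) :
    ∃ f : StrongDual ℂ (StrongDual ℂ X), ∀ ω : StrongDual ℂ X,
      Tendsto (fun i => ω (x i)) U (𝓝 (f ω)) := by
  let J : ℕ → WeakDual ℂ (StrongDual ℂ X) := fun i =>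
    StrongDual.toWeakDual (NormedSpace.inclusionInDoubleDual ℂ X (x i))
  -- Banach–Alaoglu: the image of the sequence lies in a weak-* compact ball of the bidual, so its
  -- pushforward ultrafilter converges there.
  have hK := WeakDual.isCompact_closedBall (𝕜 := ℂ) (0 : StrongDual ℂ (StrongDual ℂ X)) C
  obtain ⟨f, -, hf⟩ := hK.ultrafilter_le_nhds (U.map J) (by
    rw [Ultrafilter.coe_map, le_principal_iff, mem_map]
    refine Eventually.of_forall fun i => ?_
    have h := NormedSpace.double_dual_bound ℂ X (x i)
    simpa [J, mem_closedBall_zero_iff] using h.trans (hx i))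
  refine ⟨WeakDual.toStrongDual f, fun ω => ?_⟩
  exact ((WeakDual.eval_continuous ω).tendsto f).comp (f := J) (show Tendsto J U (𝓝 f) from hf)

/-- A functional whose iterated limits along the products of two bounded sequences differ
witnesses the failure of Arens regularity. -/
theorem not_isArensRegular_of_iteratedLimits {A : Type*} [NonUnitalNormedRing A] [NormedSpace ℂ A]
    [IsScalarTower ℂ A A] [SMulCommClass ℂ A A] (ω : StrongDual ℂ A) (x y : ℕ → A) {C D : ℝ}
    (hx : ∀ i, ‖x i‖ ≤ C) (hy : ∀ j, ‖y j‖ ≤ D)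
    (h : ∀ i j, ω (x i * y j) = if i ≤ j then 1 else 0) : ¬ IsArensRegular A := by
  intro hreg
  let U := hyperfilter ℕ
  -- `U` is non-principal, so whatever holds for all large indices holds along `U`.
  have hU : (U : Filter ℕ) ≤ atTop := by
    rw [← Nat.cofinite_eq_atTop]; exact hyperfilter_le_cofinite
  obtain ⟨f, hf⟩ := exists_bidual_ultrafilter_limit U x hx
  obtain ⟨g, hg⟩ := exists_bidual_ultrafilter_limit U y hy
  -- Here `f` is the outer limit, over `i`, and `g` the inner one, over `j`: with `i` fixed the
  -- entries equal 1 once `j ≥ i`.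
  have h1 : arensBox f g ω = 1 := by
    refine tendsto_nhds_unique (hf (g.comp (arensLeft ω))) ?_
    refine tendsto_const_nhds.congr fun i => ?_
    refine (tendsto_nhds_unique (hg (arensLeft ω (x i))) ?_).symm
    refine tendsto_const_nhds.congr' (hU ?_)
    filter_upwards [eventually_ge_atTop i] with j hj
    rw [arensLeft_apply, h, if_pos hj]
  -- The order is reversed: with `j` fixed the entries vanish once `i > j`.
  have h0 : arensDiamond f g ω = 0 := by
    refine tendsto_nhds_unique (hg (f.comp (arensRight ω))) ?_
    refine tendsto_const_nhds.congr fun j => ?_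
    refine (tendsto_nhds_unique (hf (arensRight ω (y j))) ?_).symm
    refine tendsto_const_nhds.congr' (hU ?_)
    filter_upwards [eventually_gt_atTop j] with i hi
    rw [arensRight_apply, h, if_neg hi.not_ge]
  rw [hreg f g, h0] at h1
  exact zero_ne_one h1

end Criterion

/-! ### Bilinear forms and functionals on the projective tensor product -/

section Bilinear

/-- Two square-summable families of functionals define a contractive bilinear form. -/
theorem exists_bilinear_hasSum {E F ι : Type*} [SeminormedAddCommGroup E] [NormedSpace ℂ E]
    [SeminormedAddCommGroup F] [NormedSpace ℂ F] (φ : ι → E →ₗ[ℂ] ℂ) (ψ : ι → F →ₗ[ℂ] ℂ)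
    (hφ : ∀ x (s : Finset ι), ∑ i ∈ s, ‖φ i x‖ ^ 2 ≤ ‖x‖ ^ 2)
    (hψ : ∀ y (s : Finset ι), ∑ i ∈ s, ‖ψ i y‖ ^ 2 ≤ ‖y‖ ^ 2) :
    ∃ m : E →ₗ[ℂ] F →ₗ[ℂ] ℂ, (∀ x y, ‖m x y‖ ≤ ‖x‖ * ‖y‖) ∧
      ∀ x y, HasSum (fun i => φ i x * ψ i y) (m x y) := by
  -- Cauchy–Schwarz on finite partial sums; this uniform bound gives both absolute summability and
  -- contractivity.
  have hb : ∀ x y (s : Finset ι), ∑ i ∈ s, ‖φ i x * ψ i y‖ ≤ ‖x‖ * ‖y‖ := by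
    intro x y s
    simp only [norm_mul]
    refine abs_le_of_sq_le_sq' ?_ (by positivity) |>.2
    rw [mul_pow]
    exact (Finset.sum_mul_sq_le_sq_mul_sq s _ _).trans
      (mul_le_mul (hφ x s) (hψ y s) (by positivity) (by positivity))
  have hs : ∀ x y, Summable fun i => ‖φ i x * ψ i y‖ := fun x y =>
    summable_of_sum_le (fun _ => norm_nonneg _) (hb x y)
  have hs' : ∀ x y, Summable fun i => φ i x * ψ i y := fun x y => (hs x y).of_norm
  refine ⟨LinearMap.mk₂ ℂ (fun x y => ∑' i, φ i x * ψ i y) ?_ ?_ ?_ ?_, ?_, ?_⟩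
  · intro x x' y
    simp only [map_add, add_mul]
    exact (hs' x y).tsum_add (hs' x' y)
  · intro c x y
    simp only [map_smul, smul_mul_assoc]
    exact (hs' x y).tsum_const_smul c
  · intro x y y'
    simp only [map_add, mul_add]
    exact (hs' x y).tsum_add (hs' x y')
  · intro c x y
    simp only [map_smul, mul_smul_comm]
    exact (hs' x y).tsum_const_smul c
  · intro x y
    exact (norm_tsum_le_tsum_norm (hs x y)).trans ((hs x y).tsum_le_of_sum_le (hb x y))
  · intro x y
    exact (hs' x y).hasSum

variable {A B : Type*}
  [NonUnitalNormedRing A] [NormedSpace ℂ A] [IsScalarTower ℂ A A] [SMulCommClass ℂ A A]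
  [NonUnitalNormedRing B] [NormedSpace ℂ B] [IsScalarTower ℂ B B] [SMulCommClass ℂ B B]

theorem AlgTensor.norm_tmul_le (a : A) (b : B) : ‖tmul a b‖ ≤ ‖a‖ * ‖b‖ :=
  norm_le (costs_tmul a b)

/-- A contractive bilinear form extends to a functional on the projective tensor product. -/
theorem ProjectiveTensorProduct.exists_functional (m : A →ₗ[ℂ] B →ₗ[ℂ] ℂ)
    (hm : ∀ a b, ‖m a b‖ ≤ ‖a‖ * ‖b‖) :
    ∃ ω : StrongDual ℂ (ProjectiveTensorProduct A B),
      ∀ a b, ω (ofAlg A B (AlgTensor.tmul a b)) = m a b := by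
  let l : AlgTensor A B →ₗ[ℂ] ℂ := TensorProduct.lift m
  have hl : ∀ a b, l (AlgTensor.tmul a b) = m a b := fun a b => TensorProduct.lift.tmul a b
  have hbound : ∀ u, ‖l u‖ ≤ 1 * ‖u‖ := by
    intro u
    rw [one_mul]
    -- The projective norm is an infimum over representations, so it is enough to bound `l u` by the
    -- cost of each one.
    refine le_csInf (AlgTensor.costs_nonempty u) ?_
    rintro _ ⟨n, a, b, rfl, rfl⟩
    rw [map_sum]
    refine (norm_sum_le _ _).trans (Finset.sum_le_sum fun i _ => ?_)
    rw [hl]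
    exact hm _ _
  refine ⟨(l.mkContinuous 1 hbound).extend (ofAlg A B), fun a b => ?_⟩
  rw [ContinuousLinearMap.extend_eq _ denseRange_ofAlg (UniformSpace.Completion.isUniformInducing_coe _)]
  exact hl a b

end Bilinear

/-! ### Rank-one operators and Hilbert–Schmidt estimates in the Schatten class -/

section SchattenBounds

open InnerProductSpace

variable {H : Type*} [NormedAddCommGroup H] [InnerProductSpace ℂ H] [CompleteSpace H]

namespace Schatten

theorem isBessel_of_orthonormal {ι : Type*} {v : ι → H} (hv : Orthonormal ℂ v) : IsBessel v :=
  bessel hv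

/-- Each coefficient factors as `⟪y, e k⟫ * ⟪f k, x⟫`. The inequality of arithmetic and geometric
means splits the product into squares, which the two Bessel inequalities sum. -/
theorem tsum_enorm_inner_rpow_le {κ : Type*} {p : ℝ} (hp : 1 ≤ p) {e f : κ → H}
    (he : IsBessel e) (hf : IsBessel f) {x y : H} (hx : ‖x‖ ≤ 1) (hy : ‖y‖ ≤ 1) :
    ∑' k, ‖inner ℂ (f k) (rankOne ℂ x y (e k))‖ₑ ^ p ≤ 1 := by
  have hx' : ‖x‖ₑ ≤ 1 := by rwa [← ofReal_norm, ENNReal.ofReal_le_one]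
  have hy' : ‖y‖ₑ ≤ 1 := by rwa [← ofReal_norm, ENNReal.ofReal_le_one]
  have hle : ∀ {z w : H}, ‖z‖ₑ ≤ 1 → ‖w‖ₑ ≤ 1 → ‖inner ℂ z w‖ₑ ≤ 1 := by
    intro z w hz hw
    have h : ‖inner ℂ z w‖ₑ ≤ ‖z‖ₑ * ‖w‖ₑ := by
      rw [← ofReal_norm, ← ofReal_norm, ← ofReal_norm, ← ENNReal.ofReal_mul (norm_nonneg _)]
      exact ENNReal.ofReal_le_ofReal (norm_inner_le_norm _ _)
    exact h.trans (mul_le_one' hz hw)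
  calc ∑' k, ‖inner ℂ (f k) (rankOne ℂ x y (e k))‖ₑ ^ p
      ≤ ∑' k, 2⁻¹ * (‖inner ℂ (e k) y‖ₑ ^ 2 + ‖inner ℂ (f k) x‖ₑ ^ 2) := by
        refine ENNReal.tsum_le_tsum fun k => ?_
        rw [rankOne_apply, inner_smul_right, enorm_mul, enorm_inner_comm y]
        -- The base is at most 1 and `1 ≤ p`, so the `p`-th power is at most the base itself.
        refine (ENNReal.rpow_le_rpow_of_exponent_ge ?_ hp).trans ?_
        · exact mul_le_one' (hle (he.enorm_le_one k) hy') (hle (hf.enorm_le_one k) hx')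
        · rw [ENNReal.rpow_one]
          exact enorm_mul_le_half _ _
    _ = 2⁻¹ * (∑' k, ‖inner ℂ (e k) y‖ₑ ^ 2 + ∑' k, ‖inner ℂ (f k) x‖ₑ ^ 2) := by
        rw [ENNReal.tsum_mul_left, ENNReal.tsum_add]
    _ ≤ 1 := half_add_le_one ((he y).trans (pow_le_one' hy' 2)) ((hf x).trans (pow_le_one' hx' 2))

/-- Since the Schatten norm is attained as an `ℓ^p` sum of coefficients over some pair of Bessel
families, the preceding estimate applies and the absolute value of the operator need not be
computed. -/
theorem schattenENorm_rankOne_le {p : ℝ} (hp : 1 ≤ p) {x y : H} (hx : ‖x‖ ≤ 1) (hy : ‖y‖ ≤ 1) :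
    schattenENorm p (rankOne ℂ x y) ≤ 1 := by
  have hp0 : 0 < p := by linarith
  have hc : IsCompactOperator (rankOne ℂ x y : H →L[ℂ] H) := by
    have h1 : IsCompactOperator (innerSL ℂ y) :=
      isCompactOperator_of_locallyCompactSpace_dom (R₁ := ℂ) (R₂ := ℂ)
        (σ₁₂ := RingHom.id ℂ) (innerSL ℂ y)
    exact h1.clm_comp (ContinuousLinearMap.toSpanSingleton ℂ x)
  obtain ⟨κ, e, f, he, hf, h⟩ := exists_schatten_eq hp0 hc
  rw [h]
  exact ENNReal.rpow_le_one (tsum_enorm_inner_rpow_le hp he hf hx hy) (by positivity)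

/-- For `p ≤ 2` the matrix coefficients of an operator with respect to Bessel families are
square-summable, with sum at most the square of the Schatten `p`-norm. -/
theorem tsum_enorm_inner_sq_le {κ μ : Type*} {p : ℝ} (hp : 0 < p) (hp2 : p ≤ 2) {T : H →L[ℂ] H}
    (hT : IsCompactOperator T) {e : κ → H} {f : μ → H} (he : IsBessel e) (hf : IsBessel f) :
    ∑' k, ∑' l, ‖inner ℂ (f k) (T (e l))‖ₑ ^ 2 ≤ schattenENorm p T ^ 2 := by
  obtain ⟨ι, u, s, v, hTu, hv, -, htr⟩ := exists_singular (isCompact_abs_iff.2 hT)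
  have hsum : schattenENorm p T = (∑' i, (s i : ℝ≥0∞) ^ p) ^ (1 / p) := by
    rw [schattenENorm, htr p hp]
  have hN : schattenENorm p T ^ p = ∑' i, (s i : ℝ≥0∞) ^ p := by
    rw [hsum, one_div, ENNReal.rpow_inv_rpow hp.ne']
  -- Each singular value is dominated by the whole `ℓ^p` sum.
  have hle : ∀ i, (s i : ℝ≥0∞) ≤ schattenENorm p T := fun i => by
    rw [hsum, one_div, ENNReal.le_rpow_inv_iff hp]
    exact ENNReal.le_tsum i
  have hadj : ∀ x y, inner ℂ x (T y) = inner ℂ (star T x) y := fun x y =>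
    (ContinuousLinearMap.adjoint_inner_left T y x).symm
  -- This replaces `e` by the singular basis `u`: both sides concern the vector `star T (f k)`,
  -- whose squared norm is given exactly by Parseval for `u` and bounds the Bessel sum for `e`.
  have hrow : ∀ k, ∑' l, ‖inner ℂ (f k) (T (e l))‖ₑ ^ 2 ≤
      ∑' i, ‖inner ℂ (f k) (T (u i))‖ₑ ^ 2 := fun k => by
    simp only [hadj, enorm_inner_comm (star T (f k))]
    rw [parseval u]
    exact he _
  have hse : ∀ i, ‖((s i : ℝ) : ℂ)‖ₑ = s i := fun i => by
    rw [← ofReal_norm, Complex.norm_real, Real.norm_of_nonneg (NNReal.coe_nonneg _),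
      ENNReal.ofReal_coe_nnreal]
  calc ∑' k, ∑' l, ‖inner ℂ (f k) (T (e l))‖ₑ ^ 2
      ≤ ∑' k, ∑' i, ‖inner ℂ (f k) (T (u i))‖ₑ ^ 2 := ENNReal.tsum_le_tsum hrow
    _ = ∑' i, ∑' k, ‖inner ℂ (f k) (T (u i))‖ₑ ^ 2 := ENNReal.tsum_comm
    _ ≤ ∑' i, ‖T (u i)‖ₑ ^ 2 := ENNReal.tsum_le_tsum fun i => hf _
    _ ≤ ∑' i, (s i : ℝ≥0∞) ^ (2 : ℝ) := by
        refine ENNReal.tsum_le_tsum fun i => ?_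
        rw [hTu, enorm_smul, hse, ENNReal.rpow_two]
        gcongr
        exact mul_le_of_le_one_right' (hv.enorm_le_one i)
    -- Write `s ^ 2 = s ^ p * s ^ (2 - p)` and bound the second factor by `hle`; this requires `2 -
    -- p ≥ 0`.
    _ ≤ ∑' i, (s i : ℝ≥0∞) ^ p * schattenENorm p T ^ (2 - p) := by
        refine ENNReal.tsum_le_tsum fun i => ?_
        rw [show (2 : ℝ) = p + (2 - p) by ring,
          ENNReal.rpow_add_of_nonneg _ _ hp.le (by linarith), add_sub_cancel]
        gcongr
        exact hle i
    _ = schattenENorm p T ^ 2 := by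
        rw [ENNReal.tsum_mul_right, ← hN, ← ENNReal.rpow_add_of_nonneg _ _ hp.le (by linarith),
          add_sub_cancel, ENNReal.rpow_two]

end Schatten

namespace SchattenClass

/-- The rank-one operator `z ↦ ⟪y, z⟫ x` between vectors of norm at most one, as an element of
the Schatten class. -/
noncomputable def rankOne (p : ℝ) [Fact (1 ≤ p)] {x y : H} (hx : ‖x‖ ≤ 1) (hy : ‖y‖ ≤ 1) : SchattenClass p H :=
  ⟨InnerProductSpace.rankOne ℂ x y,
    (Schatten.schattenENorm_rankOne_le Fact.out hx hy).trans_lt ENNReal.one_lt_top⟩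

variable {p : ℝ} [Fact (1 ≤ p)]

theorem norm_rankOne_le {x y : H} (hx : ‖x‖ ≤ 1) (hy : ‖y‖ ≤ 1) : ‖rankOne p hx hy‖ ≤ 1 := by
  have h := Schatten.schattenENorm_rankOne_le (p := p) Fact.out hx hy
  exact (ENNReal.toReal_mono ENNReal.one_ne_top h).trans_eq ENNReal.toReal_one

/-- The matrix coefficient `T ↦ ⟪x, T y⟫`. -/
noncomputable def coeff (p : ℝ) [Fact (1 ≤ p)] (x y : H) : SchattenClass p H →ₗ[ℂ] ℂ where
  toFun T := inner ℂ x (T.1 y)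
  map_add' _ _ := inner_add_right _ _ _
  map_smul' _ _ := inner_smul_right _ _ _

theorem coeff_apply (x y : H) (T : SchattenClass p H) : coeff p x y T = inner ℂ x (T.1 y) := rfl

/-- The multiplication rule for matrix units, read off on coefficients: with vectors from an
orthonormal family it says that `E i 0 * E 0 j` has the single nonzero coefficient `(i, j)`. -/
theorem coeff_rankOne_mul_rankOne {x y z w : H} (hx : ‖x‖ ≤ 1) (hy : ‖y‖ ≤ 1) (hz : ‖z‖ ≤ 1)
    (hw : ‖w‖ ≤ 1) (v v' : H) :
    coeff p v v' (rankOne p hx hy * rankOne p hz hw) =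
      inner ℂ w v' * (inner ℂ y z * inner ℂ v x) := by
  have h : coeff p v v' (rankOne p hx hy * rankOne p hz hw) =
    inner ℂ v (InnerProductSpace.rankOne ℂ x y (InnerProductSpace.rankOne ℂ z w v')) := rfl
  simp only [h, rankOne_apply, map_smul, inner_smul_right]

/-- The Hilbert–Schmidt bound in the finite-sum form required by `exists_bilinear_hasSum`, with row
and column merged into one index. -/
theorem sum_coeff_sq_le (hp2 : p ≤ 2) {κ : Type*} {e : κ → H} (he : Orthonormal ℂ e)
    (T : SchattenClass p H) (s : Finset (κ × κ)) :
    ∑ q ∈ s, ‖coeff p (e q.1) (e q.2) T‖ ^ 2 ≤ ‖T‖ ^ 2 := by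
  have hp : (0 : ℝ) < p := zero_lt_one.trans_le Fact.out
  have hb := Schatten.isBessel_of_orthonormal he
  have h := Schatten.tsum_enorm_inner_sq_le hp hp2 (Schatten.isCompact_of_schatten hp T.2) hb hb
  rw [← ENNReal.tsum_prod] at h
  have h2 := ENNReal.toReal_mono (ENNReal.pow_ne_top T.2.ne) ((ENNReal.sum_le_tsum s).trans h)
  rw [ENNReal.toReal_sum fun _ _ => by simp, ENNReal.toReal_pow] at h2
  simpa [coeff_apply, norm_def] using h2

end SchattenClass
end SchattenBounds

/-! ### Orthonormal families, the shifting contractions and the counterexample -/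

section Main

variable {H : Type*} [NormedAddCommGroup H] [InnerProductSpace ℂ H] [CompleteSpace H]

/-- A countable part of an orthonormal basis suffices, so separability of `H` plays no role. -/
theorem exists_orthonormal_of_infinite (hH : ¬ FiniteDimensional ℂ H) (κ : Type*) [Countable κ] :
    ∃ e : κ → H, Orthonormal ℂ e := by
  let b := Schatten.basis H
  have hinf : Infinite (Schatten.basisSet H) := by
    by_contra hfin
    rw [not_infinite_iff_finite] at hfin
    have := Fintype.ofFinite (Schatten.basisSet H)
    exact hH b.toOrthonormalBasis.toBasis.finiteDimensional_of_finite
  obtain ⟨n, hn⟩ := exists_injective_nat κ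
  let j := Infinite.natEmbedding (Schatten.basisSet H)
  exact ⟨fun k => b (j (n k)), b.orthonormal.comp _ (j.injective.comp hn)⟩

/-- A contraction carrying one orthonormal family to another. -/
theorem exists_contraction_map_orthonormal {κ : Type*} {v w : κ → H} (hv : Orthonormal ℂ v)
    (hw : Orthonormal ℂ w) : ∃ a : H →L[ℂ] H, ‖a‖ ≤ 1 ∧ ∀ k, a (v k) = w k := by
  classical
  let V := hv.orthogonalFamily.linearIsometry
  let W := hw.orthogonalFamily.linearIsometry
  have hV : ∀ k, V (lp.single 2 k 1) = v k := fun k => by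
    simp [V, OrthogonalFamily.linearIsometry_apply_single]
  have hW : ∀ k, W (lp.single 2 k 1) = w k := fun k => by
    simp [W, OrthogonalFamily.linearIsometry_apply_single]
  -- `V` and `W` embed `ℓ²(κ)` isometrically along the two families. The operator `W V*` is a
  -- contraction, and it maps `v k` to `w k` because `V* V = 1`.
  refine ⟨W.toContinuousLinearMap ∘L ContinuousLinearMap.adjoint V.toContinuousLinearMap, ?_, ?_⟩
  · refine (ContinuousLinearMap.opNorm_comp_le _ _).trans (mul_le_one₀ ?_ (norm_nonneg _) ?_)
    · exact W.norm_toContinuousLinearMap_le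
    · rw [LinearIsometryEquiv.norm_map]
      exact V.norm_toContinuousLinearMap_le
  · intro k
    have h : ContinuousLinearMap.adjoint V.toContinuousLinearMap (V (lp.single 2 k 1)) =
        lp.single 2 k 1 := by
      refine ext_inner_left ℂ fun z => ?_
      rw [ContinuousLinearMap.adjoint_inner_right]
      exact V.inner_map_map _ _
    rw [ContinuousLinearMap.comp_apply, ← hV, h]
    exact hW k

end Main

theorem mainTheorem9 {H : Type*} [NormedAddCommGroup H] [InnerProductSpace ℂ H]
    [CompleteSpace H] (hH : ¬ FiniteDimensional ℂ H) (p : ℝ) [Fact (1 ≤ p)] (hp2 : p ≤ 2) :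
    ¬ IsArensRegular (ProjectiveTensorProduct (H →L[ℂ] H) (SchattenClass p H)) := by
  obtain ⟨e, he⟩ := exists_orthonormal_of_infinite hH (ℕ × ℕ)
  have he1 : ∀ q, ‖e q‖ ≤ 1 := fun q => (he.1 q).le
  have hrow : ∀ i, Orthonormal ℂ fun k => e (i, k) := fun i =>
    he.comp _ (Prod.mk_right_injective i)
  choose a ha ha' using fun i => exists_contraction_map_orthonormal (hrow 0) (hrow i)
  -- Evaluation at one unit vector makes the coordinates square-summable with bound `‖T‖ ^ 2`, for
  -- any bounded `T`.
  let φ : ℕ × ℕ → (H →L[ℂ] H) →ₗ[ℂ] ℂ := fun q =>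
    ((innerSL ℂ (e q)).comp (ContinuousLinearMap.apply ℂ H (e (0, 0)))).toLinearMap
  have hφ' : ∀ q T, φ q T = inner ℂ (e q) (T (e (0, 0))) := fun _ _ => rfl
  -- The triangular cut-off is what makes the two iterated limits differ.
  let ψ : ℕ × ℕ → SchattenClass p H →ₗ[ℂ] ℂ := fun q =>
    if q.1 ≤ q.2 then SchattenClass.coeff p (e (0, q.1)) (e (0, q.2)) else 0
  obtain ⟨m, hm, hmsum⟩ := exists_bilinear_hasSum φ ψ (fun T s => by
      simp only [hφ']
      refine (he.sum_inner_products_le _).trans (pow_le_pow_left₀ (norm_nonneg _) ?_ 2)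
      simpa [he.1] using T.le_opNorm (e (0, 0)))
    (fun T s => by
      refine le_trans (Finset.sum_le_sum fun q _ => ?_)
        (SchattenClass.sum_coeff_sq_le hp2 (hrow 0) T s)
      simp only [ψ]
      split_ifs
      · exact le_rfl
      · simp)
  obtain ⟨ω, hω⟩ := ProjectiveTensorProduct.exists_functional m hm
  have hnorm : ∀ (T : H →L[ℂ] H) (S : SchattenClass p H), ‖T‖ ≤ 1 → ‖S‖ ≤ 1 →
      ‖ProjectiveTensorProduct.ofAlg _ _ (AlgTensor.tmul T S)‖ ≤ 1 := fun T S hT hS => by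
    rw [ProjectiveTensorProduct.norm_ofAlg]
    exact (AlgTensor.norm_tmul_le T S).trans (mul_le_one₀ hT (norm_nonneg _) hS)
  -- The sequences are `a i ⊗ E i 0` and `E j 0 ⊗ E 0 j`; every factor has norm at most 1.
  refine not_isArensRegular_of_iteratedLimits ω
    (fun i => ProjectiveTensorProduct.ofAlg _ _
      (AlgTensor.tmul (a i) (SchattenClass.rankOne p (he1 (0, i)) (he1 (0, 0)))))
    (fun j => ProjectiveTensorProduct.ofAlg _ _
      (AlgTensor.tmul (InnerProductSpace.rankOne ℂ (e (0, j)) (e (0, 0)))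
        (SchattenClass.rankOne p (he1 (0, 0)) (he1 (0, j)))))
    (fun i => hnorm _ _ (ha i) (SchattenClass.norm_rankOne_le _ _))
    (fun j => hnorm _ _ (by simp [he.1])
      (SchattenClass.norm_rankOne_le _ _)) fun i j => ?_
  rw [← ProjectiveTensorProduct.ofAlg_mul, AlgTensor.tmul_mul_tmul, hω]
  refine (hmsum _ _).unique ?_
  have hprod : (a i * InnerProductSpace.rankOne ℂ (e (0, j)) (e (0, 0))) (e (0, 0)) = e (i, j) := by
    change a i (InnerProductSpace.rankOne ℂ (e (0, j)) (e (0, 0)) (e (0, 0))) = _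
    rw [InnerProductSpace.rankOne_apply, inner_self_eq_norm_sq_to_K, he.1]
    simp [ha']
  have hon := orthonormal_iff_ite.1 he
  -- Since `φ q` of the first leg is `⟪e q, e (i, j)⟫`, only the term `q = (i, j)` survives, and `ψ
  -- (i, j)` of the matrix unit `E i j` is 1 or 0 according to the cut-off.
  convert hasSum_ite_eq (i, j) (if i ≤ j then (1 : ℂ) else 0) using 2 with q
  obtain ⟨k, l⟩ := q
  rw [hφ', hprod, hon]
  by_cases hq : (k, l) = (i, j)
  · obtain ⟨rfl, rfl⟩ := Prod.mk.inj hq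
    simp only [ψ, if_true, one_mul]
    split_ifs
    · rw [SchattenClass.coeff_rankOne_mul_rankOne]
      simp [he.1]
    · rfl
  · simp [hq]
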